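/- Fix $d\in\mathbb N$ and a fermionic time-reversal map $\Theta$ on $\ell^2(\mathbb Z^2,\mathbb C^d)$, that is, an antiunitary operator with $\Theta^2=-\mathbb 1$ that commutes with the position operators $x_1,x_2$. A bounded selfadjoint operator $H$ on $\ell^2(\mathbb Z^2,\mathbb C^d)$ is called a local, $\Theta$-invariant Hamiltonian if $H\Theta=\Theta H$ and its kernel satisfies, for some $\nu>0$, $|H(x,y)|\le \nu^{-1}e^{-2\nu|x-y|}$ for all $x,y\in\mathbb Z^2$. It is insulating at energy $E_F\in\mathbb R$ if $E_F\notin\operatorname{Spec}(H)$; in this case, with $P=\mathbb 1_{(-\infty,E_F)}(H)$, $P^\perp=\mathbb 1-P$, and $L$ the operator of multiplication by $x\mapsto e^{i\arg(x_1+ix_2)}$ (with $\arg 0=0$), its Fu--Kane--Mele $\mathbb Z_2$-index is $\mathcal I(H)=\dim\ker(PLP+P^\perp)\bmod 2$. Theorem. Let $E_F\in\mathbb R$ and let $H$ be a local, $\Theta$-invariant Hamiltonian that models an interface system at energy $E_F$: there are a set $\Omega\subset\mathbb R^2$ and two local, $\Theta$-invariant Hamiltonians $H_+,H_-$ on $\ell^2(\mathbb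 Z^2,\mathbb C^d)$ such that (i) for every $R>0$ there are $a_+,a_-\in\mathbb R^2$ such that the Euclidean balls of radius $R$ in $\mathbb R^2$ centered at $a_+$ and $a_-$ are contained in $\Omega$ and $\Omega^c$, respectively; (ii) $H_+$ and $H_-$ are insulating at energy $E_F$ and $\mathcal I(H_+)\ne\mathcal I(H_-)$; (iii) the kernel of the edge operator $E=H-\mathbb 1_\Omega H_+\mathbb 1_\Omega-\mathbb 1_{\Omega^c}H_-\mathbb 1_{\Omega^c}$ satisfies, for some $\nu>0$, $|E(x,y)|\le\nu^{-1}e^{-\nu d(x,\partial\Omega)}$ for all $x,y\in\mathbb Z^2$, where $\partial\Omega$ is the boundary of $\Omega$ in $\mathbb R^2$. Then $E_F\in\operatorname{Spec}(H)$. -/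

import Mathlib

open scoped ENNReal

noncomputable section

namespace Interface

/-- The lattice `ℤ²`. -/
abbrev Lattice : Type := Fin 2 → ℤ

/-- The Euclidean plane `ℝ²`. -/
abbrev Plane : Type := EuclideanSpace ℝ (Fin 2)

/-- The inclusion `ℤ² ⊂ ℝ²`. -/
def toPlane (x : Lattice) : Plane := WithLp.toLp 2 (fun j => (x j : ℝ))

/-- The Hilbert space `ℓ²(ℤ², ℂᵈ)`. -/
abbrev State (d : ℕ) : Type := lp (fun _ : Lattice => EuclideanSpace ℂ (Fin d)) 2

/-- Bounded operators on `ℓ²(ℤ², ℂᵈ)`. -/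
abbrev Op (d : ℕ) : Type := State d →L[ℂ] State d

/-- The kernel `A(x, y)` of a bounded operator, a `d × d` matrix viewed as a linear map of `ℂᵈ`:
`A(x, y) v` is the value at `x` of `A (δ_y ⊗ v)`. -/
def kernel {d : ℕ} (A : Op d) (x y : Lattice) :
    EuclideanSpace ℂ (Fin d) →L[ℂ] EuclideanSpace ℂ (Fin d) :=
  (lp.evalCLM ℂ (fun _ : Lattice => EuclideanSpace ℂ (Fin d)) 2 x).comp
    (A.comp (lp.singleContinuousLinearMap ℂ (fun _ : Lattice => EuclideanSpace ℂ (Fin d)) 2 y))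

/-- The multiplication operator by a function `m : ℤ² → ℂ` bounded by one:
`(mulOp m u)(x) = m(x) u(x)`. -/
def mulOp (d : ℕ) (m : Lattice → ℂ) (hm : ∀ x, ‖m x‖ ≤ 1) : Op d :=
  LinearMap.mkContinuous
    { toFun := fun u => ⟨fun x => m x • u x, (lp.memℓp u).mono' fun x => by
        rw [norm_smul]
        exact mul_le_of_le_one_left (norm_nonneg _) (hm x)⟩
      map_add' := fun u v => by
        ext1
        funext x
        exact smul_add (m x) (u x) (v x)
      map_smul' := fun c u => by
        ext1
        funext x
        exact smul_comm (m x) c (u x) }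
    1 (fun u => by
      rw [one_mul]
      refine lp.norm_mono two_ne_zero fun x => ?_
      refine (norm_smul (m x) (u x)).trans_le ?_
      exact mul_le_of_le_one_left (norm_nonneg _) (hm x))

theorem mulOp_apply (d : ℕ) (m : Lattice → ℂ) (hm : ∀ x, ‖m x‖ ≤ 1) (u : State d) (x : Lattice) :
    mulOp d m hm u x = m x • u x := rfl

open Classical in
/-- Multiplication by the indicator function of `S ⊂ ℝ²`, restricted to `ℤ²`. -/
def indicatorOp (d : ℕ) (S : Set Plane) : Op d :=
  mulOp d (fun x => if toPlane x ∈ S then 1 else 0) (fun x => by split_ifs <;> simp)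

/-- The Laughlin flux insertion operator: multiplication by `exp (i arg (x₁ + i x₂))`
(with `arg 0 = 0`). -/
def laughlin (d : ℕ) : Op d :=
  mulOp d
    (fun x => Complex.exp (Complex.I * (Complex.arg ((x 0 : ℂ) + Complex.I * (x 1 : ℂ)) : ℂ)))
    (fun x => by rw [mul_comm]; exact (Complex.norm_exp_ofReal_mul_I _).le)

/-- `Θ` is a fermionic time-reversal map: antiunitary, `Θ² = -1`, and commuting with the (unbounded)
position operators `x₁, x₂`: if `u` is in the domain of `x_j` and `v = x_j u`, then `Θ u` is in the
domain of `x_j` and `x_j (Θ u) = Θ v`. -/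
structure IsTimeReversal {d : ℕ} (Θ : State d →ₛₗ[starRingEnd ℂ] State d) : Prop where
  antiunitary : ∀ u v : State d, inner ℂ (Θ u) (Θ v) = starRingEnd ℂ (inner ℂ u v)
  sq_eq_neg : ∀ u : State d, Θ (Θ u) = -u
  commutes_position : ∀ (j : Fin 2) (u v : State d), (∀ x, v x = (x j : ℂ) • u x) →
    ∀ x, Θ v x = (x j : ℂ) • Θ u x

/-- Exponential off-diagonal decay of the kernel. -/
def IsLocal {d : ℕ} (H : Op d) : Prop :=
  ∃ ν : ℝ, 0 < ν ∧ ∀ x y : Lattice,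
    ‖kernel H x y‖ ≤ ν⁻¹ * Real.exp (-2 * ν * dist (toPlane x) (toPlane y))

/-- `[H, Θ] = 0`. -/
def IsInvariant {d : ℕ} (Θ : State d →ₛₗ[starRingEnd ℂ] State d) (H : Op d) : Prop :=
  ∀ u : State d, H (Θ u) = Θ (H u)

/-- A local, `Θ`-invariant Hamiltonian (bounded and selfadjoint). -/
structure IsHamiltonian {d : ℕ} (Θ : State d →ₛₗ[starRingEnd ℂ] State d) (H : Op d) : Prop where
  selfAdjoint : IsSelfAdjoint H
  isLocal : IsLocal H
  invariant : IsInvariant Θ H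

/-- `E_F` is not in the spectrum of `H`. -/
def IsInsulating {d : ℕ} (H : Op d) (EF : ℝ) : Prop := (EF : ℂ) ∉ spectrum ℂ H

/-- The spectral projection `1_{(-∞, E_F)}(H)` of a bounded selfadjoint operator `H` on a complex
Hilbert space, for `E_F` outside the spectrum of `H`. The indicator function is then continuous on
the spectrum, so that the continuous functional calculus applies. -/
def fermiProj {E : Type*} [NormedAddCommGroup E] [InnerProductSpace ℂ E] [CompleteSpace E]
    (H : E →L[ℂ] E) (EF : ℝ) : E →L[ℂ] E :=
  cfc (fun t : ℝ => if t < EF then (1 : ℝ) else 0) H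

/-- The `ℤ₂`-index `dim ker (P L P + P^⊥) mod 2`. -/
def index {d : ℕ} (H : Op d) (EF : ℝ) : ZMod 2 :=
  (Module.finrank ℂ
    (LinearMap.ker ((fermiProj H EF * laughlin d * fermiProj H EF + (1 - fermiProj H EF) : Op d) :
      State d →ₗ[ℂ] State d)) : ZMod 2)

/-- The edge operator `H - 1_Ω H₊ 1_Ω - 1_{Ωᶜ} H₋ 1_{Ωᶜ}`. -/
def edgeOp {d : ℕ} (H Hp Hm : Op d) (Ω : Set Plane) : Op d :=
  H - indicatorOp d Ω * Hp * indicatorOp d Ω - indicatorOp d Ωᶜ * Hm * indicatorOp d Ωᶜ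

/-- `H` models an interface system at energy `E_F`. -/
def ModelsInterface {d : ℕ} (Θ : State d →ₛₗ[starRingEnd ℂ] State d) (H : Op d) (EF : ℝ) : Prop :=
  IsHamiltonian Θ H ∧
  ∃ (Ω : Set Plane) (Hp Hm : Op d),
    IsHamiltonian Θ Hp ∧ IsHamiltonian Θ Hm ∧
    (∀ R : ℝ, 0 < R → ∃ ap am : Plane, Metric.ball ap R ⊆ Ω ∧ Metric.ball am R ⊆ Ωᶜ) ∧
    IsInsulating Hp EF ∧ IsInsulating Hm EF ∧ index Hp EF ≠ index Hm EF ∧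
    ∃ ν : ℝ, 0 < ν ∧ ∀ x y : Lattice,
      ‖kernel (edgeOp H Hp Hm Ω) x y‖ ≤
        ν⁻¹ * Real.exp (-ν * Metric.infDist (toPlane x) (frontier Ω))

end Interface

end

namespace Interface

/-! Suppose `EF` also lies in a gap of `H`. Then `H` has an index of its own, and it is enough that
this index equals that of `Hp`: exchanging Ω with its complement gives the same for `Hm`,
contradicting (ii).

The index can be measured at any site. Moving the flux tube from the origin to `a` changes the
multiplier by a term vanishing at infinity, and the parity is constant along the segment between the
two multipliers (`even_finrank_ker_compress_congr`). Deep inside Ω the edge term is negligible, so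
`H` and `Hp` agree near the centres of ever larger balls (`agreeNear_of_edgeOp`), and so do their
Fermi projections, which are norm limits of polynomials (`agreeNear_fermiProj`). For a flux tube at
such a centre, the defect `1 - T*T` of the compression `T` is concentrated near the centre,
uniformly in the centre (`isConcentrated_defect_of_isFluxLike`). Hence the defects for `Hp` and `H`
become close in norm.

Both comparisons rest on `even_finrank_ker_iff`. Time reversal exchanges `T` and `T*`, so ⟨ΘTu, v⟩
is a skew form, nondegenerate away from `ker T`; the part of `1 - T*T` above a level `s < 1`
therefore has rank of the same parity as `dim ker T`, provided it is finite. If `T` and `T'` had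
different parities, the ranks of their defects could never coincide, and alternating between two
close defects at decreasing levels would push the rank past its bound. The range of a positive part
(`upperRange`) serves as spectral subspace, so that the continuous functional calculus suffices. -/

open Polynomial in
-- One polynomial serves both operators, so a comparison of `f(a)` with `f(b)` reduces to algebra in
-- `a` and `b`.
theorem exists_polynomial_cfc_near {A : Type*} [CStarAlgebra A] {a b : A} (ha : IsSelfAdjoint a)
    (hb : IsSelfAdjoint b) {f : ℝ → ℝ} (hf : Continuous f) {ε : ℝ} (hε : 0 < ε) :
    ∃ p : ℝ[X], ‖cfc f a - aeval a p‖ ≤ ε ∧ ‖cfc f b - aeval b p‖ ≤ ε := by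
  -- This interval contains both spectra.
  obtain ⟨p, hp⟩ := exists_polynomial_near_of_continuousOn (-(‖a‖ * ‖(1 : A)‖ + ‖b‖ * ‖(1 : A)‖))
    (‖a‖ * ‖(1 : A)‖ + ‖b‖ * ‖(1 : A)‖) f hf.continuousOn ε hε
  have key : ∀ c : A, IsSelfAdjoint c →
      ‖c‖ * ‖(1 : A)‖ ≤ ‖a‖ * ‖(1 : A)‖ + ‖b‖ * ‖(1 : A)‖ → ‖cfc f c - aeval c p‖ ≤ ε := by
    intro c hc hle
    rw [← cfc_polynomial p c hc, ← cfc_sub f p.eval c hf.continuousOn p.continuous.continuousOn]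
    refine norm_cfc_le hε.le fun x hx => ?_
    have h1 : ‖x‖ ≤ ‖c‖ * ‖(1 : A)‖ := spectrum.norm_le_norm_mul_of_mem hx
    rw [Real.norm_eq_abs] at h1 ⊢
    rw [abs_sub_comm]
    exact (hp x ⟨by linarith [neg_abs_le x], by linarith [le_abs_self x]⟩).le
  exact ⟨p, key a ha (by have := mul_nonneg (norm_nonneg b) (norm_nonneg (1 : A)); linarith),
    key b hb (by have := mul_nonneg (norm_nonneg a) (norm_nonneg (1 : A)); linarith)⟩

theorem eq_of_forall_norm_sub_le {F : Type*} [NormedAddCommGroup F] {x y : F} (K : ℝ)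
    (h : ∀ ε : ℝ, 0 < ε → ‖x - y‖ ≤ K * ε) : x = y := by
  rw [← sub_eq_zero, ← norm_le_zero_iff]
  refine le_of_forall_pos_le_add fun ε hε => ?_
  have hK : 0 < |K| + 1 := by positivity
  have h1 := h (ε / (|K| + 1)) (by positivity)
  have h2 : K * (ε / (|K| + 1)) ≤ (|K| + 1) * (ε / (|K| + 1)) := by
    gcongr
    linarith [le_abs_self K]
  rw [mul_div_cancel₀ _ hK.ne'] at h2
  linarith

/-! ### Spectral subspaces and Kramers parity on a Hilbert space -/

section Hilbert

variable {E : Type*} [NormedAddCommGroup E] [InnerProductSpace ℂ E]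

open scoped InnerProductSpace

theorem map_real_smul (J : E →ₛₗ[starRingEnd ℂ] E) (r : ℝ) (u : E) : J (r • u) = r • J u := by
  rw [RCLike.real_smul_eq_coe_smul (K := ℂ), map_smulₛₗ, RCLike.conj_ofReal,
    ← RCLike.real_smul_eq_coe_smul (K := ℂ)]

theorem re_inner_sub_smul (A : E →L[ℂ] E) (s : ℝ) (u : E) :
    (⟪(A - s • (1 : E →L[ℂ] E)) u, u⟫_ℂ).re = (⟪A u, u⟫_ℂ).re - s * ‖u‖ ^ 2 := by
  rw [sub_apply, inner_sub_left, Complex.sub_re]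
  congr 1
  simp only [smul_apply, one_apply_eq_self]
  rw [RCLike.real_smul_eq_coe_smul (K := ℂ), inner_smul_left, inner_self_eq_norm_sq_to_K]
  simp [← Complex.ofReal_pow]

variable [CompleteSpace E]

open Polynomial in
/-- A bounded antilinear map commuting with a selfadjoint operator commutes with its real
functional calculus. -/
theorem antilinear_cfc_comm {A : E →L[ℂ] E} (hA : IsSelfAdjoint A)
    (J : E →ₛₗ[starRingEnd ℂ] E) {C : ℝ} (hC : ∀ u, ‖J u‖ ≤ C * ‖u‖)
    (hc : ∀ u, J (A u) = A (J u)) {f : ℝ → ℝ} (hf : Continuous f) (u : E) :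
    J (cfc f A u) = cfc f A (J u) := by
  have hpow : ∀ (n : ℕ) u, J ((A ^ n) u) = (A ^ n) (J u) := by
    intro n
    induction n with
    | zero => intro u; simp
    | succ n ih => intro u; simp only [pow_succ, mul_apply_eq_comp, ih, hc]
  -- Real coefficients pass through an antilinear map without conjugation.
  have hpoly : ∀ p : ℝ[X], ∀ u, J (aeval A p u) = aeval A p (J u) := by
    intro p
    induction p using Polynomial.induction_on' with
    | add p q hp hq => intro u; simp [hp, hq]
    | monomial n r =>
      intro u
      simp only [aeval_monomial, Algebra.algebraMap_eq_smul_one, smul_mul_assoc, one_mul]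
      rw [smul_apply, smul_apply, map_real_smul, hpow]
  refine eq_of_forall_norm_sub_le (|C| * ‖u‖ + ‖J u‖) fun ε hε => ?_
  obtain ⟨p, hp, -⟩ := exists_polynomial_cfc_near hA hA hf hε
  have e : J (cfc f A u) - cfc f A (J u) =
      J ((cfc f A - aeval A p) u) - (cfc f A - aeval A p) (J u) := by
    simp only [sub_apply, map_sub, hpoly]
    abel
  rw [e]
  have h1 : ‖J ((cfc f A - aeval A p) u)‖ ≤ |C| * (ε * ‖u‖) :=
    (hC _).trans (mul_le_mul (le_abs_self C) (ContinuousLinearMap.le_of_opNorm_le _ hp u)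
      (norm_nonneg _) (abs_nonneg C))
  have h2 := ContinuousLinearMap.le_of_opNorm_le _ hp (J u)
  calc _ ≤ _ := norm_sub_le _ _
    _ ≤ _ := by linarith

/-- The range of the positive part of `A - s`. -/
noncomputable def upperRange (A : E →L[ℂ] E) (s : ℝ) : Submodule ℂ E :=
  LinearMap.range ((cfc (fun t : ℝ => max (t - s) 0) A : E →L[ℂ] E) : E →ₗ[ℂ] E)

theorem sub_smul_one_eq_cfc {A : E →L[ℂ] E} (hA : IsSelfAdjoint A) (s : ℝ) :
    A - s • (1 : E →L[ℂ] E) =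
      cfc (fun t : ℝ => max (t - s) 0) A - cfc (fun t : ℝ => max (s - t) 0) A := by
  rw [← cfc_sub _ _ A (by fun_prop) (by fun_prop)]
  have : (fun t : ℝ => max (t - s) 0 - max (s - t) 0) = fun t => t - s := by
    funext t
    rcases le_total t s with h | h
    · rw [max_eq_right (by linarith), max_eq_left (by linarith)]; ring
    · rw [max_eq_left (by linarith), max_eq_right (by linarith)]; ring
  rw [this, cfc_sub (fun t : ℝ => t) (fun _ => s) A (by fun_prop) (by fun_prop), cfc_id' ℝ A hA,
    cfc_const s A hA, Algebra.algebraMap_eq_smul_one]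

theorem cfc_max_mul_cfc_max (A : E →L[ℂ] E) (s : ℝ) :
    cfc (fun t : ℝ => max (s - t) 0) A * cfc (fun t : ℝ => max (t - s) 0) A = 0 := by
  rw [← cfc_mul _ _ A (by fun_prop) (by fun_prop)]
  have : (fun t : ℝ => max (s - t) 0 * max (t - s) 0) = fun _ => 0 := by
    funext t
    rcases le_total t s with h | h
    · rw [max_eq_right (a := t - s) (by linarith), mul_zero]
    · rw [max_eq_right (a := s - t) (by linarith), zero_mul]
  rw [this, cfc_const_zero]

theorem re_inner_cfc_nonneg (A : E →L[ℂ] E) {f : ℝ → ℝ} (hf : ∀ t, 0 ≤ f t) (u : E) :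
    0 ≤ (⟪cfc f A u, u⟫_ℂ).re := by
  have h : 0 ≤ cfc f A := cfc_nonneg fun x _ => hf x
  rw [ContinuousLinearMap.nonneg_iff_isPositive] at h
  exact h.re_inner_nonneg_left u

theorem inner_cfc_comm (A : E →L[ℂ] E) (f : ℝ → ℝ) (u v : E) :
    ⟪cfc f A u, v⟫_ℂ = ⟪u, cfc f A v⟫_ℂ := by
  have h : IsSelfAdjoint (cfc f A) := cfc_predicate f A
  exact (ContinuousLinearMap.isSelfAdjoint_iff_isSymmetric.1 h) u v

/-- The negative part of `A - s` annihilates the range of the positive part, so `A - s` acts there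
as a nonnegative operator. -/
theorem le_re_inner_of_mem_upperRange {A : E →L[ℂ] E} (hA : IsSelfAdjoint A) {s : ℝ} {u : E}
    (hu : u ∈ upperRange A s) : s * ‖u‖ ^ 2 ≤ (⟪A u, u⟫_ℂ).re := by
  obtain ⟨w, rfl⟩ := hu
  simp only [ContinuousLinearMap.coe_coe]
  rw [← sub_nonneg, ← re_inner_sub_smul, sub_smul_one_eq_cfc hA, sub_apply,
    ← mul_apply_eq_comp (cfc (fun t : ℝ => max (s - t) 0) A), cfc_max_mul_cfc_max]
  simp only [zero_apply, sub_zero]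
  exact re_inner_cfc_nonneg A (fun t => le_max_right _ _) _

/-- The positive part, being selfadjoint, annihilates the orthogonal complement of its range; only
minus the negative part remains. -/
theorem re_inner_le_of_mem_orthogonal_upperRange {A : E →L[ℂ] E} (hA : IsSelfAdjoint A) {s : ℝ}
    {u : E} (hu : u ∈ (upperRange A s)ᗮ) : (⟪A u, u⟫_ℂ).re ≤ s * ‖u‖ ^ 2 := by
  have h0 : cfc (fun t : ℝ => max (t - s) 0) A u = 0 := by
    rw [← inner_self_eq_zero (𝕜 := ℂ), inner_cfc_comm]
    exact (Submodule.mem_orthogonal' _ _).1 hu _ ⟨_, rfl⟩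
  rw [← sub_nonpos, ← re_inner_sub_smul, sub_smul_one_eq_cfc hA, sub_apply, h0,
    zero_sub, inner_neg_left, Complex.neg_re, neg_nonpos]
  exact re_inner_cfc_nonneg A (fun t => le_max_right _ _) _

/-- With `p`, `q` the positive and negative parts, applying `q` to `pu - qu = (1 - s)u` and pairing
with `u` gives `-‖qu‖² = (1 - s)⟨qu, u⟩ ≥ 0`. So `qu = 0`, and `u` is exactly `p` of a multiple of
itself. -/
theorem mem_upperRange_of_apply_eq_self {A : E →L[ℂ] E} (hA : IsSelfAdjoint A) {s : ℝ} (hs : s < 1)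
    {u : E} (hu : A u = u) : u ∈ upperRange A s := by
  set p := cfc (fun t : ℝ => max (t - s) 0) A with hp
  set q := cfc (fun t : ℝ => max (s - t) 0) A with hq
  have h1 : p u - q u = (1 - s) • u := by
    rw [← sub_apply, ← sub_smul_one_eq_cfc hA]
    simp [hu, sub_smul]
  have h2 : -(q (q u)) = (1 - s) • q u := by
    have h3 : q (p u) = 0 := by
      rw [← mul_apply_eq_comp, cfc_max_mul_cfc_max, zero_apply]
    have := congrArg q h1
    rw [map_sub, h3, zero_sub] at this
    rw [this, ContinuousLinearMap.map_smul_of_tower]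
  have h4 : q u = 0 := by
    have h5 : ⟪q (q u), u⟫_ℂ = ⟪q u, q u⟫_ℂ := inner_cfc_comm A _ _ _
    have h6 := congrArg (fun v => (⟪v, u⟫_ℂ).re) h2
    simp only [inner_neg_left, h5, RCLike.real_smul_eq_coe_smul (K := ℂ), inner_smul_left,
      Complex.neg_re] at h6
    have h7 : 0 ≤ (⟪q u, u⟫_ℂ).re := re_inner_cfc_nonneg A (fun t => le_max_right _ _) _
    rw [inner_self_eq_norm_sq_to_K] at h6
    simp [← Complex.ofReal_pow] at h6
    have : ‖q u‖ ^ 2 ≤ 0 := by nlinarith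
    simpa using this
  rw [h4, sub_zero] at h1
  have h8 : p ((1 - s)⁻¹ • u) = u := by
    rw [ContinuousLinearMap.map_smul_of_tower, h1, smul_smul, inv_mul_cancel₀ (by linarith),
      one_smul]
  exact ⟨_, h8⟩

/-- The form is at least `s` on the range and at most `r < s` on `ker χ`, so `χ` is injective on the
range. -/
theorem finrank_upperRange_le {A : E →L[ℂ] E} (hA : IsSelfAdjoint A) {r s : ℝ} (hrs : r < s)
    {G : Type*} [AddCommGroup G] [Module ℂ G] [FiniteDimensional ℂ G] (χ : E →ₗ[ℂ] G)
    (hχ : ∀ u, χ u = 0 → (⟪A u, u⟫_ℂ).re ≤ r * ‖u‖ ^ 2) :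
    FiniteDimensional ℂ (upperRange A s) ∧
      Module.finrank ℂ (upperRange A s) ≤ Module.finrank ℂ G := by
  have hinj : Function.Injective (χ.domRestrict (upperRange A s)) := by
    rw [← LinearMap.ker_eq_bot, LinearMap.ker_eq_bot']
    intro u hu
    have h1 := hχ u hu
    have h2 := le_re_inner_of_mem_upperRange hA u.2
    have h3 : ‖(u : E)‖ ^ 2 ≤ 0 := by nlinarith [sq_nonneg ‖(u : E)‖]
    ext
    simpa using h3
  exact ⟨FiniteDimensional.of_injective _ hinj, LinearMap.finrank_le_finrank_of_injective hinj⟩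

/-- Min-max principle, with the projection onto the subspace of `B` as the finite-rank test map. -/
theorem finrank_upperRange_le_finrank_upperRange {A B : E →L[ℂ] E} (hA : IsSelfAdjoint A)
    (hB : IsSelfAdjoint B) {s s' : ℝ} [FiniteDimensional ℂ (upperRange B s')]
    (h : ‖A - B‖ < s - s') :
    Module.finrank ℂ (upperRange A s) ≤ Module.finrank ℂ (upperRange B s') := by
  refine (finrank_upperRange_le hA (r := s' + ‖A - B‖) (by linarith)
    ((upperRange B s').orthogonalProjectionOnto : E →ₗ[ℂ] upperRange B s') fun u hu => ?_).2
  have h1 : u ∈ (upperRange B s')ᗮ := by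
    simpa using hu
  have h2 := re_inner_le_of_mem_orthogonal_upperRange hB h1
  have h3 : (⟪(A - B) u, u⟫_ℂ).re ≤ ‖A - B‖ * ‖u‖ ^ 2 := by
    refine (Complex.re_le_norm _).trans ((norm_inner_le_norm _ _).trans ?_)
    rw [pow_two, ← mul_assoc]
    gcongr
    exact ContinuousLinearMap.le_opNorm _ _
  rw [sub_apply, inner_sub_left, Complex.sub_re] at h3
  linarith

/-- In odd dimension a skew matrix satisfies `det M = -det M`. -/
theorem even_finrank_of_skew_separating {W : Type*} [AddCommGroup W] [Module ℂ W]
    [FiniteDimensional ℂ W] (B : W →ₗ[ℂ] W →ₗ[ℂ] ℂ) (hB : ∀ u v, B u v = -B v u)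
    (hB' : ∀ u, (∀ v, B u v = 0) → u = 0) : Even (Module.finrank ℂ W) := by
  let b := Module.finBasis ℂ W
  have hdet := (LinearMap.separatingLeft_iff_det_ne_zero (B := B) b).1 hB'
  by_contra hodd
  have hskew : (LinearMap.toMatrix₂ b b B).transpose = -LinearMap.toMatrix₂ b b B := by
    ext i j
    simp only [Matrix.transpose_apply, Matrix.neg_apply, LinearMap.toMatrix₂_apply]
    exact hB _ _
  have h := congrArg Matrix.det hskew
  rw [Matrix.det_transpose, Matrix.det_neg, Fintype.card_fin,
    (Nat.not_even_iff_odd.1 hodd).neg_one_pow, neg_one_mul] at h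
  exact hdet (self_eq_neg.1 h)

/-- Time-reversal symmetry of an operator that exchanges it with its adjoint. -/
structure IsOddSymmetric (Θ : E →ₛₗ[starRingEnd ℂ] E) (T : E →L[ℂ] E) : Prop where
  antiunitary : ∀ u v, ⟪Θ u, Θ v⟫_ℂ = starRingEnd ℂ ⟪u, v⟫_ℂ
  sq_eq_neg : ∀ u, Θ (Θ u) = -u
  map_apply : ∀ u, Θ (T u) = star T (Θ u)

namespace IsOddSymmetric

variable {Θ : E →ₛₗ[starRingEnd ℂ] E} {T : E →L[ℂ] E}

theorem norm_map (h : IsOddSymmetric Θ T) (u : E) : ‖Θ u‖ = ‖u‖ := by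
  have := congrArg Complex.re (h.antiunitary u u)
  rw [inner_self_eq_norm_sq_to_K, inner_self_eq_norm_sq_to_K] at this
  simp [← Complex.ofReal_pow] at this
  exact this

theorem map_star_apply (h : IsOddSymmetric Θ T) (u : E) : Θ (star T u) = T (Θ u) := by
  have h1 := h.map_apply (Θ u)
  rw [h.sq_eq_neg, map_neg] at h1
  have h2 := congrArg Θ h1
  rw [h.sq_eq_neg, map_neg] at h2
  exact (neg_injective h2).symm

/-- The sign comes from `Θ² = -1`; this is where the fermionic nature of Θ enters. -/
theorem inner_skew (h : IsOddSymmetric Θ T) (u v : E) : ⟪Θ (T u), v⟫_ℂ = -⟪Θ (T v), u⟫_ℂ := by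
  have h1 : ⟪Θ (T v), u⟫_ℂ = ⟪Θ v, T u⟫_ℂ := by
    rw [h.map_apply, ContinuousLinearMap.star_eq_adjoint, ContinuousLinearMap.adjoint_inner_left]
  have h2 := h.antiunitary (Θ v) (T u)
  rw [h.sq_eq_neg, inner_neg_left, inner_conj_symm] at h2
  have h3 := congrArg (starRingEnd ℂ) h2
  rw [map_neg, inner_conj_symm, inner_conj_symm] at h3
  rw [h1, ← h3, neg_neg]

theorem isSelfAdjoint_defect (T : E →L[ℂ] E) : IsSelfAdjoint (1 - star T * T) :=
  (IsSelfAdjoint.one _).sub (IsSelfAdjoint.star_mul_self T)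

theorem ker_le_upperRange (T : E →L[ℂ] E) {s : ℝ} (hs : s < 1) :
    LinearMap.ker (T : E →ₗ[ℂ] E) ≤ upperRange (1 - star T * T) s := by
  intro u hu
  refine mem_upperRange_of_apply_eq_self (isSelfAdjoint_defect T) hs ?_
  have : T u = 0 := hu
  simp [this]

/-- From `ΘT = T*Θ` and `ΘT* = TΘ`, the antilinear map `ΘT` commutes with `1 - T*T`, hence with its
positive part. -/
theorem map_mem_upperRange (h : IsOddSymmetric Θ T) {s : ℝ} {u : E}
    (hu : u ∈ upperRange (1 - star T * T) s) : Θ (T u) ∈ upperRange (1 - star T * T) s := by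
  obtain ⟨w, rfl⟩ := hu
  have key := antilinear_cfc_comm (isSelfAdjoint_defect T)
    (Θ.comp (T : E →ₗ[ℂ] E) : E →ₛₗ[starRingEnd ℂ] E) (C := ‖T‖)
    (fun u => (h.norm_map _).trans_le (T.le_opNorm u))
    (fun u => by
      simp only [LinearMap.comp_apply, ContinuousLinearMap.coe_coe, sub_apply,
        one_apply_eq_self, mul_apply_eq_comp, map_sub]
      rw [h.map_apply, h.map_apply (star T (T u)), h.map_star_apply, h.map_apply])
    (f := fun t : ℝ => max (t - s) 0) (by fun_prop) w
  exact ⟨_, key.symm⟩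

/-- Kramers pairing: the complement of `ker T` in the spectral subspace carries a nondegenerate skew
form, so its dimension is even. -/
theorem finrank_upperRange_mod_two (h : IsOddSymmetric Θ T) {s : ℝ} (hs : s < 1)
    [FiniteDimensional ℂ (upperRange (1 - star T * T) s)] :
    Even (Module.finrank ℂ (upperRange (1 - star T * T) s)) ↔
      Even (Module.finrank ℂ (LinearMap.ker (T : E →ₗ[ℂ] E))) := by
  set V := upperRange (1 - star T * T) s with hV
  set K := LinearMap.ker (T : E →ₗ[ℂ] E) with hK
  have hdim := Submodule.finrank_add_inf_finrank_orthogonal (ker_le_upperRange T hs)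
  have hfin : FiniteDimensional ℂ ↥(Kᗮ ⊓ V) := Submodule.finiteDimensional_of_le inf_le_right
  have heven : Even (Module.finrank ℂ ↥(Kᗮ ⊓ V)) := by
    refine even_finrank_of_skew_separating
      (LinearMap.mk₂ ℂ (fun u v : ↥(Kᗮ ⊓ V) => ⟪Θ (T u), (v : E)⟫_ℂ) ?_ ?_ ?_ ?_) ?_ ?_
    · intro u v w; simp
    · intro c u v; simp [mul_comm]
    · intro u v w; simp
    · intro c u v; simp
    · intro u v
      exact h.inner_skew _ _
    · rintro ⟨u, hu⟩ hv
      -- Nondegeneracy: `ΘTu` itself lies in the space and pairs with `u` to give `‖Tu‖²`. It is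
      -- orthogonal to the kernel by skewness.
      have hmem : Θ (T u) ∈ Kᗮ ⊓ V := by
        refine ⟨?_, h.map_mem_upperRange hu.2⟩
        refine (Submodule.mem_orthogonal' _ _).2 fun k hk => ?_
        have : T k = 0 := hk
        rw [h.inner_skew, this]
        simp
      have h0 : Θ (T u) = 0 := by
        rw [← inner_self_eq_zero (𝕜 := ℂ)]
        exact hv ⟨_, hmem⟩
      have h1 : T u = 0 := by rw [← norm_eq_zero, ← h.norm_map, h0, norm_zero]
      have h2 : ⟪u, u⟫_ℂ = 0 := (Submodule.mem_orthogonal _ _).1 hu.1 u h1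
      ext
      simpa using h2
  rw [← hK, ← hV] at hdim
  rw [← hdim, Nat.even_add]
  exact iff_true_right heven

/-- The parity of the kernel dimension is stable, uniformly in a bound on the number of singular
values below `√3 / 2`. -/
theorem even_finrank_ker_iff {T' : E →L[ℂ] E} (h : IsOddSymmetric Θ T) (h' : IsOddSymmetric Θ T')
    (hfin : ∀ s : ℝ, 0 < s → s < 1 → FiniteDimensional ℂ (upperRange (1 - star T * T) s))
    (hfin' : ∀ s : ℝ, 0 < s → s < 1 → FiniteDimensional ℂ (upperRange (1 - star T' * T') s))
    {N : ℕ} (hN : Module.finrank ℂ (upperRange (1 - star T * T) (1 / 4)) ≤ N) {η : ℝ}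
    (hη : ‖(1 - star T * T) - (1 - star T' * T')‖ < η) (hηN : (2 * N + 4) * η ≤ 1 / 2) :
    Even (Module.finrank ℂ (LinearMap.ker (T : E →ₗ[ℂ] E))) ↔
      Even (Module.finrank ℂ (LinearMap.ker (T' : E →ₗ[ℂ] E))) := by
  by_contra hne
  have hη0 : 0 < η := (norm_nonneg _).trans_lt hη
  have hA := isSelfAdjoint_defect T
  have hA' := isSelfAdjoint_defect T'
  have hη' : ‖(1 - star T' * T') - (1 - star T * T)‖ < η := by rwa [norm_sub_rev]
  -- Lowering the level by `η` passes from the rank of one defect to at least that rank for the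
  -- other. The parities differ, so the first of each two such moves is strict and the rank gains at
  -- least one per `2η`. After `N + 1` rounds the level is `1 - (2N + 3)η > 1/2`, still above `1/4`,
  -- where the rank is at most `N`.
  have key : ∀ k : ℕ, k ≤ N + 1 →
      k ≤ Module.finrank ℂ (upperRange (1 - star T * T) (1 - (2 * k + 1) * η)) := by
    intro k
    induction k with
    | zero => intro _; exact Nat.zero_le _
    | succ k ih =>
      intro hk
      have hkN : (k : ℝ) + 1 ≤ N + 1 := by exact_mod_cast hk
      have hb : (2 * ((k : ℝ) + 1) + 1) * η ≤ (2 * N + 4) * η :=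
        mul_le_mul_of_nonneg_right (by linarith) hη0.le
      have hk0 : (0 : ℝ) ≤ k := Nat.cast_nonneg k
      have b1 : 1 - (2 * (k : ℝ) + 1) * η < 1 := by nlinarith
      have b2 : 1 - (2 * (k : ℝ) + 2) * η < 1 := by nlinarith
      have b3 : 1 - (2 * ((k : ℝ) + 1) + 1) * η < 1 := by nlinarith
      have c1 : 0 < 1 - (2 * (k : ℝ) + 1) * η := by nlinarith
      have c2 : 0 < 1 - (2 * (k : ℝ) + 2) * η := by nlinarith
      have c3 : 0 < 1 - (2 * ((k : ℝ) + 1) + 1) * η := by nlinarith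
      have := hfin _ c1 b1
      have := hfin' _ c2 b2
      have := hfin _ c3 b3
      have e1 := ih (by omega)
      have e2 := finrank_upperRange_le_finrank_upperRange hA hA' (s := 1 - (2 * (k : ℝ) + 1) * η)
        (s' := 1 - (2 * (k : ℝ) + 2) * η) (by linarith)
      have e3 := finrank_upperRange_le_finrank_upperRange hA' hA (s := 1 - (2 * (k : ℝ) + 2) * η)
        (s' := 1 - (2 * ((k : ℝ) + 1) + 1) * η) (by linarith)
      have p1 := h.finrank_upperRange_mod_two b1
      have p2 := h'.finrank_upperRange_mod_two b2
      have hne' : Module.finrank ℂ (upperRange (1 - star T * T) (1 - (2 * (k : ℝ) + 1) * η)) ≠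
          Module.finrank ℂ (upperRange (1 - star T' * T') (1 - (2 * (k : ℝ) + 2) * η)) := by
        intro he
        rw [he] at p1
        exact hne (p1.symm.trans p2)
      rw [Nat.cast_succ]
      omega
  have h1 := key (N + 1) le_rfl
  have := hfin (1 / 4) (by norm_num) (by norm_num)
  have h2 := finrank_upperRange_le_finrank_upperRange hA hA
    (s := 1 - (2 * ((N + 1 : ℕ) : ℝ) + 1) * η) (s' := 1 / 4) (by
      rw [sub_self, norm_zero]; push_cast; nlinarith)
  omega

end IsOddSymmetric

end Hilbert
end Interface

namespace Interface

/-! ### Multiplication operators and lattice cutoffs -/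

section Multiplication

variable {d : ℕ}

theorem norm_mulOp_le (m : Lattice → ℂ) (hm : ∀ x, ‖m x‖ ≤ 1) : ‖mulOp d m hm‖ ≤ 1 :=
  LinearMap.mkContinuous_norm_le _ zero_le_one _

theorem mulOp_mul_mulOp {m m' n : Lattice → ℂ} (hm : ∀ x, ‖m x‖ ≤ 1) (hm' : ∀ x, ‖m' x‖ ≤ 1)
    (hn : ∀ x, ‖n x‖ ≤ 1) (h : ∀ x, m x * m' x = n x) :
    mulOp d m hm * mulOp d m' hm' = mulOp d n hn := by
  ext u x : 3
  rw [mul_apply_eq_comp, mulOp_apply, mulOp_apply, mulOp_apply, smul_smul, h]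

theorem mulOp_comm {m m' : Lattice → ℂ} (hm : ∀ x, ‖m x‖ ≤ 1) (hm' : ∀ x, ‖m' x‖ ≤ 1) :
    mulOp d m hm * mulOp d m' hm' = mulOp d m' hm' * mulOp d m hm := by
  ext u x : 3
  simp only [mul_apply_eq_comp, mulOp_apply, smul_smul, mul_comm]

theorem star_mulOp {m n : Lattice → ℂ} (hm : ∀ x, ‖m x‖ ≤ 1) (hn : ∀ x, ‖n x‖ ≤ 1)
    (h : ∀ x, n x = starRingEnd ℂ (m x)) : star (mulOp d m hm) = mulOp d n hn := by
  rw [ContinuousLinearMap.star_eq_adjoint]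
  refine ((ContinuousLinearMap.eq_adjoint_iff _ _).2 fun u v => ?_).symm
  rw [lp.inner_eq_tsum, lp.inner_eq_tsum]
  refine tsum_congr fun x => ?_
  rw [mulOp_apply, mulOp_apply, inner_smul_left, inner_smul_right, h, Complex.conj_conj]

open Classical in
/-- Multiplication by the indicator function of a ball of the lattice. -/
noncomputable def cutoff (d : ℕ) (a : Lattice) (ρ : ℝ) : Op d :=
  mulOp d (fun x => if dist x a ≤ ρ then 1 else 0) (fun x => by split_ifs <;> simp)

open Classical in
theorem cutoff_apply (a : Lattice) (ρ : ℝ) (u : State d) (x : Lattice) :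
    cutoff d a ρ u x = if dist x a ≤ ρ then u x else 0 := by
  rw [cutoff, mulOp_apply]
  split_ifs <;> simp

theorem norm_cutoff_le (a : Lattice) (ρ : ℝ) : ‖cutoff d a ρ‖ ≤ 1 := norm_mulOp_le _ _

open Classical in
theorem one_sub_cutoff_eq (a : Lattice) (ρ : ℝ) : 1 - cutoff d a ρ =
    mulOp d (fun x => if dist x a ≤ ρ then 0 else 1) (fun x => by split_ifs <;> simp) := by
  ext u x : 3
  rw [mulOp_apply, sub_apply, one_apply_eq_self, lp.coeFn_sub, Pi.sub_apply, cutoff_apply]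
  split_ifs <;> simp

theorem norm_one_sub_cutoff_le (a : Lattice) (ρ : ℝ) : ‖1 - cutoff d a ρ‖ ≤ 1 := by
  rw [one_sub_cutoff_eq]
  exact norm_mulOp_le _ _

theorem norm_mul_le_left {A B : Op d} (h : ‖A‖ ≤ 1) : ‖A * B‖ ≤ ‖B‖ :=
  (norm_mul_le _ _).trans (mul_le_of_le_one_left (norm_nonneg _) h)

theorem norm_mul_le_right {A B : Op d} (h : ‖B‖ ≤ 1) : ‖A * B‖ ≤ ‖A‖ :=
  (norm_mul_le _ _).trans (mul_le_of_le_one_right (norm_nonneg _) h)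

end Multiplication

section Commutator

variable {R : Type*} [Ring R] {x m f c : R}

/-- If `m` acts as one on the support of `c` and as zero on that of `x`, the block of `f` between
them is a block of the commutator `[f, m]`. -/
theorem mul_mul_eq_mul_commutator_mul (h : x * m = 0) (h' : m * c = c) :
    x * f * c = x * (f * m - m * f) * c := by
  rw [mul_sub, sub_mul, ← mul_assoc x m, h, zero_mul, zero_mul, sub_zero, ← mul_assoc x,
    mul_assoc _ m, h']

theorem mul_mul_eq_neg_mul_commutator_mul (h : c * m = c) (h' : m * x = 0) :
    c * f * x = -(c * (f * m - m * f) * x) := by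
  rw [mul_sub, sub_mul, ← mul_assoc c f, mul_assoc (c * f), h', mul_zero, zero_sub, neg_neg,
    ← mul_assoc c, h]

end Commutator

/-! ### Quasi-local, concentrated and asymptotically agreeing families -/

section Families

variable {d : ℕ} {ι : Type*}

/-- A uniformly bounded family of operators. -/
def IsBddFamily (F : ι → Op d) : Prop := ∃ C : ℝ, 0 ≤ C ∧ ∀ i, ‖F i‖ ≤ C

/-- A bounded family of operators that almost commute with slowly varying functions. -/
def IsQuasiLocal (F : ι → Op d) : Prop :=
  IsBddFamily F ∧ ∀ ε : ℝ, 0 < ε → ∃ δ : ℝ, 0 < δ ∧ ∀ (i : ι) (m : Lattice → ℂ)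
    (hm : ∀ x, ‖m x‖ ≤ 1), (∀ x y, ‖m x - m y‖ ≤ δ * dist x y) →
      ‖F i * mulOp d m hm - mulOp d m hm * F i‖ ≤ ε

/-- A bounded family of operators with range concentrated near the centres `c`. -/
def IsConcentrated (c : ι → Lattice) (F : ι → Op d) : Prop :=
  IsBddFamily F ∧ ∀ ε : ℝ, 0 < ε → ∃ ρ₀ : ℝ, ∀ ρ, ρ₀ ≤ ρ → ∀ i,
    ‖(1 - cutoff d (c i) ρ) * F i‖ ≤ ε

/-- Two sequences of operators agree asymptotically near the centres `c`. -/
def AgreeNear (c : ℕ → Lattice) (F G : ℕ → Op d) : Prop :=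
  ∀ ρ ε : ℝ, 0 < ε → ∃ n₀ : ℕ, ∀ n, n₀ ≤ n → ‖cutoff d (c n) ρ * (F n - G n)‖ ≤ ε

namespace IsBddFamily

variable {F G : ι → Op d}

theorem const (A : Op d) : IsBddFamily fun _ : ι => A := ⟨‖A‖, norm_nonneg _, fun _ => le_rfl⟩

theorem add (hF : IsBddFamily F) (hG : IsBddFamily G) : IsBddFamily fun i => F i + G i := by
  obtain ⟨C, hC0, hC⟩ := hF
  obtain ⟨D, hD0, hD⟩ := hG
  exact ⟨C + D, add_nonneg hC0 hD0, fun i => (norm_add_le _ _).trans (add_le_add (hC i) (hD i))⟩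

theorem neg (hF : IsBddFamily F) : IsBddFamily fun i => -F i := by
  obtain ⟨C, hC0, hC⟩ := hF
  exact ⟨C, hC0, fun i => (norm_neg _).trans_le (hC i)⟩

theorem sub (hF : IsBddFamily F) (hG : IsBddFamily G) : IsBddFamily fun i => F i - G i := by
  simpa only [sub_eq_add_neg] using hF.add hG.neg

theorem mul (hF : IsBddFamily F) (hG : IsBddFamily G) : IsBddFamily fun i => F i * G i := by
  obtain ⟨C, hC0, hC⟩ := hF
  obtain ⟨D, hD0, hD⟩ := hG
  exact ⟨C * D, mul_nonneg hC0 hD0, fun i => (norm_mul_le _ _).trans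
    (mul_le_mul (hC i) (hD i) (norm_nonneg _) hC0)⟩

theorem mulOp (m : ι → Lattice → ℂ) (hm : ∀ i x, ‖m i x‖ ≤ 1) :
    IsBddFamily fun i => mulOp d (m i) (hm i) :=
  ⟨1, zero_le_one, fun _ => norm_mulOp_le _ _⟩

end IsBddFamily

namespace IsQuasiLocal

variable {F G : ι → Op d}

theorem add (hF : IsQuasiLocal F) (hG : IsQuasiLocal G) : IsQuasiLocal fun i => F i + G i := by
  refine ⟨hF.1.add hG.1, fun ε hε => ?_⟩
  obtain ⟨δ, hδ, h⟩ := hF.2 (ε / 2) (by positivity)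
  obtain ⟨δ', hδ', h'⟩ := hG.2 (ε / 2) (by positivity)
  refine ⟨min δ δ', lt_min hδ hδ', fun i m hm hl => ?_⟩
  have h1 := h i m hm fun x y => (hl x y).trans (by gcongr; exact min_le_left _ _)
  have h2 := h' i m hm fun x y => (hl x y).trans (by gcongr; exact min_le_right _ _)
  rw [add_mul, mul_add, add_sub_add_comm]
  exact (norm_add_le _ _).trans (by linarith)

theorem mul (hF : IsQuasiLocal F) (hG : IsQuasiLocal G) : IsQuasiLocal fun i => F i * G i := by
  refine ⟨hF.1.mul hG.1, fun ε hε => ?_⟩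
  obtain ⟨C, hC0, hC⟩ := hF.1
  obtain ⟨D, hD0, hD⟩ := hG.1
  obtain ⟨δ, hδ, h⟩ := hF.2 (ε / 2 / (D + 1)) (by positivity)
  obtain ⟨δ', hδ', h'⟩ := hG.2 (ε / 2 / (C + 1)) (by positivity)
  refine ⟨min δ δ', lt_min hδ hδ', fun i m hm hl => ?_⟩
  have h1 := h i m hm fun x y => (hl x y).trans (by gcongr; exact min_le_left _ _)
  have h2 := h' i m hm fun x y => (hl x y).trans (by gcongr; exact min_le_right _ _)
  have e : F i * G i * Interface.mulOp d m hm - Interface.mulOp d m hm * (F i * G i) =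
      F i * (G i * Interface.mulOp d m hm - Interface.mulOp d m hm * G i) +
        (F i * Interface.mulOp d m hm - Interface.mulOp d m hm * F i) * G i := by
    noncomm_ring
  rw [e]
  have h3 : ‖F i * (G i * Interface.mulOp d m hm - Interface.mulOp d m hm * G i)‖ ≤
      (C + 1) * (ε / 2 / (C + 1)) :=
    (norm_mul_le _ _).trans (mul_le_mul ((hC i).trans (by linarith)) h2 (norm_nonneg _)
      (by linarith))
  have h4 : ‖(F i * Interface.mulOp d m hm - Interface.mulOp d m hm * F i) * G i‖ ≤
      (ε / 2 / (D + 1)) * (D + 1) :=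
    (norm_mul_le _ _).trans (mul_le_mul h1 ((hD i).trans (by linarith)) (norm_nonneg _)
      (by positivity))
  rw [mul_div_cancel₀ _ (by positivity)] at h3
  rw [div_mul_cancel₀ _ (by positivity)] at h4
  exact (norm_add_le _ _).trans (by linarith)

theorem mulOp (m : ι → Lattice → ℂ) (hm : ∀ i x, ‖m i x‖ ≤ 1) :
    IsQuasiLocal fun i => mulOp d (m i) (hm i) := by
  refine ⟨.mulOp m hm, fun ε hε => ⟨1, one_pos, fun i n hn _ => ?_⟩⟩
  rw [mulOp_comm, sub_self, norm_zero]
  exact hε.le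

theorem smul_one (r : ℝ) : IsQuasiLocal fun _ : ι => r • (1 : Op d) := by
  refine ⟨.const _, fun ε hε => ⟨1, one_pos, fun i n hn _ => ?_⟩⟩
  rw [smul_mul_assoc, mul_smul_comm, one_mul, mul_one, sub_self, norm_zero]
  exact hε.le

theorem one : IsQuasiLocal fun _ : ι => (1 : Op d) := by
  simpa using smul_one (d := d) (ι := ι) 1

theorem sub (hF : IsQuasiLocal F) (hG : IsQuasiLocal G) : IsQuasiLocal fun i => F i - G i := by
  have := hF.add ((smul_one (-1)).mul hG)
  simpa [sub_eq_add_neg] using this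

theorem of_forall_near {A : Op d}
    (h : ∀ ε : ℝ, 0 < ε → ∃ B : Op d, ‖A - B‖ ≤ ε ∧ IsQuasiLocal fun _ : ι => B) :
    IsQuasiLocal fun _ : ι => A := by
  refine ⟨.const _, fun ε hε => ?_⟩
  obtain ⟨B, hAB, hB⟩ := h (ε / 4) (by positivity)
  obtain ⟨δ, hδ, h'⟩ := hB.2 (ε / 2) (by positivity)
  refine ⟨δ, hδ, fun i m hm hl => ?_⟩
  have h1 := h' i m hm hl
  have e : A * Interface.mulOp d m hm - Interface.mulOp d m hm * A =
      (A - B) * Interface.mulOp d m hm - Interface.mulOp d m hm * (A - B) +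
        (B * Interface.mulOp d m hm - Interface.mulOp d m hm * B) := by
    noncomm_ring
  rw [e]
  have h2 := (norm_mul_le_right (A := A - B) (norm_mulOp_le (d := d) m hm)).trans hAB
  have h3 := (norm_mul_le_left (B := A - B) (norm_mulOp_le (d := d) m hm)).trans hAB
  refine (norm_add_le _ _).trans ?_
  have h4 := norm_sub_le ((A - B) * Interface.mulOp d m hm) (Interface.mulOp d m hm * (A - B))
  linarith

open Polynomial in
theorem aeval {A : Op d} (hA : IsQuasiLocal fun _ : ι => A) (p : ℝ[X]) :
    IsQuasiLocal fun _ : ι => aeval A p := by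
  induction p using Polynomial.induction_on' with
  | add p q hp hq => simpa only [map_add] using hp.add hq
  | monomial n r =>
    have hpow : ∀ n : ℕ, IsQuasiLocal fun _ : ι => A ^ n := by
      intro n
      induction n with
      | zero => simpa using one
      | succ n ih => simpa only [pow_succ] using ih.mul hA
    simp only [aeval_monomial, Algebra.algebraMap_eq_smul_one]
    exact (smul_one r).mul (hpow n)

/-- A bump function of slope `δ` separates the two regions once they are `1/δ` apart, and the block
is then controlled by a commutator. The radius depends neither on the member of the family nor on
the centre. -/
theorem exists_norm_cutoff_le (hF : IsQuasiLocal F) (ρ : ℝ) {ε : ℝ} (hε : 0 < ε) :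
    ∃ ρ₁ : ℝ, ρ ≤ ρ₁ ∧ ∀ ρ', ρ₁ ≤ ρ' → ∀ (i : ι) (a : Lattice),
      ‖(1 - cutoff d a ρ') * F i * cutoff d a ρ‖ ≤ ε ∧
      ‖cutoff d a ρ * F i * (1 - cutoff d a ρ')‖ ≤ ε := by
  classical
  obtain ⟨δ, hδ, h⟩ := hF.2 ε hε
  refine ⟨ρ + 1 / δ, by have : 0 < 1 / δ := by positivity
                        linarith, fun ρ' hρ' i a => ?_⟩
  let φ : Lattice → ℝ := fun x => max (1 - δ * max (dist x a - ρ) 0) 0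
  have hφ0 : ∀ x, 0 ≤ φ x := fun x => le_max_right _ _
  have hφ1 : ∀ x, φ x ≤ 1 := fun x => max_le (by
    have : 0 ≤ δ * max (dist x a - ρ) 0 := by positivity
    linarith) zero_le_one
  have hφn : ∀ x, ‖(φ x : ℂ)‖ ≤ 1 := fun x => by
    rw [Complex.norm_real, Real.norm_eq_abs, abs_of_nonneg (hφ0 x)]
    exact hφ1 x
  have hφl : ∀ x y, ‖(φ x : ℂ) - φ y‖ ≤ δ * dist x y := fun x y => by
    rw [← Complex.ofReal_sub, Complex.norm_real, Real.norm_eq_abs]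
    refine (abs_max_sub_max_le_abs _ _ _).trans ?_
    rw [sub_sub_sub_cancel_left, ← mul_sub, abs_mul, abs_of_pos hδ]
    refine mul_le_mul_of_nonneg_left ((abs_max_sub_max_le_abs _ _ _).trans ?_) hδ.le
    rw [sub_sub_sub_cancel_right, dist_comm x y]
    exact abs_dist_sub_le _ _ _
  have hin : ∀ x, dist x a ≤ ρ → φ x = 1 := fun x hx => by
    simp only [φ]
    rw [max_eq_right (sub_nonpos.2 hx), mul_zero, sub_zero, max_eq_left zero_le_one]
  have hout : ∀ x, ¬ dist x a ≤ ρ' → φ x = 0 := fun x hx => by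
    have h1 : 1 / δ ≤ dist x a - ρ := by linarith
    have h2 : 1 ≤ δ * (dist x a - ρ) := by
      rw [div_le_iff₀ hδ] at h1
      linarith
    have h3 : 0 ≤ dist x a - ρ := le_trans (by positivity) h1
    simp only [φ]
    rw [max_eq_left h3, max_eq_right (by linarith)]
  have e1 : Interface.mulOp d _ hφn * cutoff d a ρ = cutoff d a ρ :=
    mulOp_mul_mulOp _ _ _ fun x => by
      by_cases hx : dist x a ≤ ρ
      · simp [hx, hin x hx]
      · simp [hx]
  have e1' : cutoff d a ρ * Interface.mulOp d _ hφn = cutoff d a ρ := by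
    exact (mulOp_comm _ _).trans e1
  have e2 : (1 - cutoff d a ρ') * Interface.mulOp d _ hφn = 0 := by
    rw [one_sub_cutoff_eq]
    ext u x : 3
    rw [mul_apply_eq_comp, mulOp_apply, mulOp_apply, smul_smul]
    by_cases hx : dist x a ≤ ρ'
    · simp [hx]
    · simp [hout x hx]
  have e2' : Interface.mulOp d _ hφn * (1 - cutoff d a ρ') = 0 := by
    rw [← e2, one_sub_cutoff_eq, mulOp_comm]
  have hc := h i _ hφn hφl
  constructor
  · rw [mul_mul_eq_mul_commutator_mul e2 e1]
    exact ((norm_mul_le_right (norm_cutoff_le _ _)).trans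
      (norm_mul_le_left (norm_one_sub_cutoff_le _ _))).trans hc
  · rw [mul_mul_eq_neg_mul_commutator_mul e1' e2', norm_neg]
    exact ((norm_mul_le_right (norm_one_sub_cutoff_le _ _)).trans
      (norm_mul_le_left (norm_cutoff_le _ _))).trans hc

end IsQuasiLocal

namespace IsConcentrated

variable {c : ι → Lattice} {F G : ι → Op d}

theorem of_forall_near (hF : IsBddFamily F)
    (h : ∀ ε : ℝ, 0 < ε → ∃ G, IsConcentrated c G ∧ ∀ i, ‖F i - G i‖ ≤ ε) :
    IsConcentrated c F := by
  refine ⟨hF, fun ε hε => ?_⟩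
  obtain ⟨G, hG, hFG⟩ := h (ε / 2) (by positivity)
  obtain ⟨ρ₀, h0⟩ := hG.2 (ε / 2) (by positivity)
  refine ⟨ρ₀, fun ρ hρ i => ?_⟩
  have e : (1 - cutoff d (c i) ρ) * F i =
      (1 - cutoff d (c i) ρ) * (F i - G i) + (1 - cutoff d (c i) ρ) * G i := by
    rw [← mul_add, sub_add_cancel]
  rw [e]
  refine (norm_add_le _ _).trans ?_
  have h1 := (norm_mul_le_left (B := F i - G i) (norm_one_sub_cutoff_le (c i) ρ)).trans (hFG i)
  linarith [h0 ρ hρ i]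

theorem add (hF : IsConcentrated c F) (hG : IsConcentrated c G) :
    IsConcentrated c fun i => F i + G i := by
  refine ⟨hF.1.add hG.1, fun ε hε => ?_⟩
  obtain ⟨ρ₀, h0⟩ := hF.2 (ε / 2) (by positivity)
  obtain ⟨ρ₁, h1⟩ := hG.2 (ε / 2) (by positivity)
  refine ⟨max ρ₀ ρ₁, fun ρ hρ i => ?_⟩
  rw [mul_add]
  refine (norm_add_le _ _).trans ?_
  linarith [h0 ρ ((le_max_left _ _).trans hρ) i, h1 ρ ((le_max_right _ _).trans hρ) i]

theorem neg (hF : IsConcentrated c F) : IsConcentrated c fun i => -F i := by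
  refine ⟨hF.1.neg, fun ε hε => ?_⟩
  obtain ⟨ρ₀, h0⟩ := hF.2 ε hε
  exact ⟨ρ₀, fun ρ hρ i => by rw [mul_neg, norm_neg]; exact h0 ρ hρ i⟩

theorem sub (hF : IsConcentrated c F) (hG : IsConcentrated c G) :
    IsConcentrated c fun i => F i - G i := by
  simpa only [sub_eq_add_neg] using hF.add hG.neg

theorem mul_right (hF : IsConcentrated c F) (hG : IsBddFamily G) :
    IsConcentrated c fun i => F i * G i := by
  refine ⟨hF.1.mul hG, fun ε hε => ?_⟩
  obtain ⟨C, hC0, hC⟩ := hG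
  obtain ⟨ρ₀, h0⟩ := hF.2 (ε / (C + 1)) (by positivity)
  refine ⟨ρ₀, fun ρ hρ i => ?_⟩
  rw [← mul_assoc]
  refine (norm_mul_le _ _).trans ?_
  calc _ ≤ (ε / (C + 1)) * (C + 1) := mul_le_mul (h0 ρ hρ i) ((hC i).trans (by linarith))
        (norm_nonneg _) (by positivity)
    _ = ε := div_mul_cancel₀ _ (by positivity)

/-- A quasi-local factor spreads the range by a bounded distance only, up to a small error. -/
theorem mul_left (hG : IsConcentrated c G) (hF : IsQuasiLocal F) :
    IsConcentrated c fun i => F i * G i := by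
  refine ⟨hF.1.mul hG.1, fun ε hε => ?_⟩
  obtain ⟨C, hC0, hC⟩ := hF.1
  obtain ⟨D, hD0, hD⟩ := hG.1
  obtain ⟨ρ₀, h0⟩ := hG.2 (ε / 2 / (C + 1)) (by positivity)
  obtain ⟨ρ₁, -, h1⟩ := hF.exists_norm_cutoff_le ρ₀ (ε := ε / 2 / (D + 1)) (by positivity)
  refine ⟨ρ₁, fun ρ hρ i => ?_⟩
  have e : (1 - cutoff d (c i) ρ) * (F i * G i) =
      (1 - cutoff d (c i) ρ) * F i * cutoff d (c i) ρ₀ * G i +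
        (1 - cutoff d (c i) ρ) * (F i * ((1 - cutoff d (c i) ρ₀) * G i)) := by
    noncomm_ring
  rw [e]
  have h2 : ‖(1 - cutoff d (c i) ρ) * F i * cutoff d (c i) ρ₀ * G i‖ ≤
      (ε / 2 / (D + 1)) * (D + 1) :=
    (norm_mul_le _ _).trans (mul_le_mul (h1 ρ hρ i (c i)).1 ((hD i).trans (by linarith))
      (norm_nonneg _) (by positivity))
  have h3 : ‖(1 - cutoff d (c i) ρ) * (F i * ((1 - cutoff d (c i) ρ₀) * G i))‖ ≤
      (C + 1) * (ε / 2 / (C + 1)) :=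
    (norm_mul_le_left (norm_one_sub_cutoff_le _ _)).trans ((norm_mul_le _ _).trans
      (mul_le_mul ((hC i).trans (by linarith)) (h0 ρ₀ le_rfl i) (norm_nonneg _) (by linarith)))
  rw [div_mul_cancel₀ _ (by positivity)] at h2
  rw [mul_div_cancel₀ _ (by positivity)] at h3
  exact (norm_add_le _ _).trans (by linarith)

end IsConcentrated

namespace AgreeNear

variable {c : ℕ → Lattice} {F G F' G' : ℕ → Op d}

theorem rfl_of (F : ℕ → Op d) : AgreeNear c F F := fun ρ ε hε =>
  ⟨0, fun n _ => by rw [sub_self, mul_zero, norm_zero]; exact hε.le⟩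

theorem add (h : AgreeNear c F G) (h' : AgreeNear c F' G') :
    AgreeNear c (fun n => F n + F' n) (fun n => G n + G' n) := by
  intro ρ ε hε
  obtain ⟨n₀, h0⟩ := h ρ (ε / 2) (by positivity)
  obtain ⟨n₁, h1⟩ := h' ρ (ε / 2) (by positivity)
  refine ⟨max n₀ n₁, fun n hn => ?_⟩
  rw [add_sub_add_comm, mul_add]
  refine (norm_add_le _ _).trans ?_
  linarith [h0 n ((le_max_left _ _).trans hn), h1 n ((le_max_right _ _).trans hn)]

theorem neg (h : AgreeNear c F G) : AgreeNear c (fun n => -F n) (fun n => -G n) := by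
  intro ρ ε hε
  obtain ⟨n₀, h0⟩ := h ρ ε hε
  refine ⟨n₀, fun n hn => ?_⟩
  rw [neg_sub_neg, ← neg_sub, mul_neg, norm_neg]
  exact h0 n hn

theorem sub (h : AgreeNear c F G) (h' : AgreeNear c F' G') :
    AgreeNear c (fun n => F n - F' n) (fun n => G n - G' n) := by
  simpa only [sub_eq_add_neg] using h.add h'.neg

/-- Write `FF' - GG' = F(F' - G') + (F - G)G'`. Quasi-locality of `F` moves the cutoff past it, at
the price of a larger radius. -/
theorem mul (h : AgreeNear c F G) (h' : AgreeNear c F' G') (hF : IsQuasiLocal F)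
    (hF' : IsBddFamily F') (hG' : IsBddFamily G') :
    AgreeNear c (fun n => F n * F' n) (fun n => G n * G' n) := by
  intro ρ ε hε
  obtain ⟨C, hC0, hC⟩ := hF.1
  obtain ⟨D, hD0, hD⟩ := hF'.sub hG'
  obtain ⟨K, hK0, hK⟩ := hG'
  obtain ⟨ρ₁, -, h1⟩ := hF.exists_norm_cutoff_le ρ (ε := ε / 3 / (D + 1)) (by positivity)
  obtain ⟨n₀, h0⟩ := h ρ (ε / 3 / (K + 1)) (by positivity)
  obtain ⟨n₁, h2⟩ := h' ρ₁ (ε / 3 / (C + 1)) (by positivity)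
  refine ⟨max n₀ n₁, fun n hn => ?_⟩
  have e : cutoff d (c n) ρ * (F n * F' n - G n * G' n) =
      cutoff d (c n) ρ * (F n * (cutoff d (c n) ρ₁ * (F' n - G' n))) +
      cutoff d (c n) ρ * F n * (1 - cutoff d (c n) ρ₁) * (F' n - G' n) +
      cutoff d (c n) ρ * (F n - G n) * G' n := by
    noncomm_ring
  rw [e]
  have b1 : ‖cutoff d (c n) ρ * (F n * (cutoff d (c n) ρ₁ * (F' n - G' n)))‖ ≤
      (C + 1) * (ε / 3 / (C + 1)) :=
    (norm_mul_le_left (norm_cutoff_le _ _)).trans ((norm_mul_le _ _).trans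
      (mul_le_mul ((hC n).trans (by linarith)) (h2 n ((le_max_right _ _).trans hn))
        (norm_nonneg _) (by linarith)))
  have b2 : ‖cutoff d (c n) ρ * F n * (1 - cutoff d (c n) ρ₁) * (F' n - G' n)‖ ≤
      (ε / 3 / (D + 1)) * (D + 1) :=
    (norm_mul_le _ _).trans (mul_le_mul (h1 ρ₁ le_rfl n (c n)).2 ((hD n).trans (by linarith))
      (norm_nonneg _) (by positivity))
  have b3 : ‖cutoff d (c n) ρ * (F n - G n) * G' n‖ ≤ (ε / 3 / (K + 1)) * (K + 1) :=
    (norm_mul_le _ _).trans (mul_le_mul (h0 n ((le_max_left _ _).trans hn))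
      ((hK n).trans (by linarith)) (norm_nonneg _) (by positivity))
  rw [mul_div_cancel₀ _ (by positivity)] at b1
  rw [div_mul_cancel₀ _ (by positivity)] at b2 b3
  exact (norm_add₃_le).trans (by linarith)

theorem of_forall_near {A B : Op d}
    (h : ∀ ε : ℝ, 0 < ε → ∃ A' B' : Op d, ‖A - A'‖ ≤ ε ∧ ‖B - B'‖ ≤ ε ∧
      AgreeNear c (fun _ => A') fun _ => B') :
    AgreeNear c (fun _ => A) fun _ => B := by
  intro ρ ε hε
  obtain ⟨A', B', hA, hB, hAB⟩ := h (ε / 3) (by positivity)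
  obtain ⟨n₀, h0⟩ := hAB ρ (ε / 3) (by positivity)
  refine ⟨n₀, fun n hn => ?_⟩
  have e : cutoff d (c n) ρ * (A - B) = cutoff d (c n) ρ * (A - A') - cutoff d (c n) ρ * (B - B') +
      cutoff d (c n) ρ * (A' - B') := by
    noncomm_ring
  rw [e]
  refine (norm_add_le _ _).trans ?_
  have h1 := norm_sub_le (cutoff d (c n) ρ * (A - A')) (cutoff d (c n) ρ * (B - B'))
  have h2 := (norm_mul_le_left (B := A - A') (norm_cutoff_le (c n) ρ)).trans hA
  have h3 := (norm_mul_le_left (B := B - B') (norm_cutoff_le (c n) ρ)).trans hB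
  linarith [h0 n hn]

open Polynomial in
theorem aeval {A B : Op d} (hAB : AgreeNear c (fun _ => A) fun _ => B)
    (hA : IsQuasiLocal fun _ : ℕ => A) (p : ℝ[X]) :
    AgreeNear c (fun _ => aeval A p) fun _ => aeval B p := by
  induction p using Polynomial.induction_on' with
  | add p q hp hq => simpa only [map_add] using hp.add hq
  | monomial n r =>
    have hpow : ∀ n : ℕ, AgreeNear c (fun _ => A ^ n) fun _ => B ^ n := by
      intro n
      induction n with
      | zero => simpa using rfl_of _
      | succ n ih =>
        simpa only [pow_succ'] using hAB.mul ih hA (.const _) (.const _)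
    simp only [aeval_monomial, Algebra.algebraMap_eq_smul_one]
    exact (rfl_of _).mul (hpow n) (.smul_one r) (.const _) (.const _)

/-- The difference is small near the centres by agreement and small far from them by concentration.
-/
theorem exists_norm_sub_le (h : AgreeNear c F G) (hF : IsConcentrated c F)
    (hG : IsConcentrated c G) {ε : ℝ} (hε : 0 < ε) :
    ∃ n₀ : ℕ, ∀ n, n₀ ≤ n → ‖F n - G n‖ ≤ ε := by
  obtain ⟨ρ₀, h0⟩ := (hF.sub hG).2 (ε / 2) (by positivity)
  obtain ⟨n₀, h1⟩ := h ρ₀ (ε / 2) (by positivity)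
  refine ⟨n₀, fun n hn => ?_⟩
  have e : F n - G n = (1 - cutoff d (c n) ρ₀) * (F n - G n) + cutoff d (c n) ρ₀ * (F n - G n) := by
    noncomm_ring
  rw [e]
  refine (norm_add_le _ _).trans ?_
  linarith [h0 ρ₀ le_rfl n, h1 n hn]

end AgreeNear

end Families
end Interface

namespace Interface

variable {d : ℕ}

/-! ### Schur's test on the lattice -/

section SchurTest

theorem kernel_apply (A : Op d) (x y : Lattice) (v : EuclideanSpace ℂ (Fin d)) :
    kernel A x y v = A (lp.single 2 y v) x := rfl

theorem kernel_sub (A B : Op d) (x y : Lattice) :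
    kernel (A - B) x y = kernel A x y - kernel B x y := by
  ext v : 1
  rfl

theorem kernel_mulOp_mul (A : Op d) {m : Lattice → ℂ} (hm : ∀ x, ‖m x‖ ≤ 1) (x y : Lattice) :
    kernel (mulOp d m hm * A) x y = m x • kernel A x y := by
  ext v : 1
  rfl

theorem kernel_mul_mulOp (A : Op d) {m : Lattice → ℂ} (hm : ∀ x, ‖m x‖ ≤ 1) (x y : Lattice) :
    kernel (A * mulOp d m hm) x y = m y • kernel A x y := by
  ext v : 1
  rw [kernel_apply, mul_apply_eq_comp, smul_apply, kernel_apply]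
  have : mulOp d m hm (lp.single 2 y v) = m y • lp.single 2 y v := by
    ext z : 2
    rw [mulOp_apply, lp.coeFn_smul, Pi.smul_apply]
    by_cases h : z = y
    · rw [h]
    · rw [lp.single_apply_ne _ _ _ h, smul_zero, smul_zero]
  rw [this, map_smul]
  rfl

theorem sum_norm_sq_le (S : Finset Lattice) (u : State d) : ∑ x ∈ S, ‖u x‖ ^ 2 ≤ ‖u‖ ^ 2 := by
  have := lp.sum_rpow_le_norm_rpow (p := 2) (by norm_num) u S
  simpa using this

theorem norm_inner_truncation_le {A : Op d} {k : Lattice → ℝ} (hk : Summable k)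
    (hk0 : ∀ z, 0 ≤ k z) (h : ∀ x y, ‖kernel A x y‖ ≤ k (x - y)) (S : Finset Lattice)
    (u w : State d) :
    ‖inner ℂ (∑ x ∈ S, lp.single 2 x (w x)) (A (∑ y ∈ S, lp.single 2 y (u y)))‖ ≤
      (∑' z, k z) * (‖w‖ ^ 2 + ‖u‖ ^ 2) / 2 := by
  have e : inner ℂ (∑ x ∈ S, lp.single 2 x (w x)) (A (∑ y ∈ S, lp.single 2 y (u y))) =
      ∑ x ∈ S, ∑ y ∈ S, inner ℂ (w x) (kernel A x y (u y)) := by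
    rw [sum_inner]
    refine Finset.sum_congr rfl fun x _ => ?_
    rw [map_sum, inner_sum]
    refine Finset.sum_congr rfl fun y _ => ?_
    rw [lp.inner_single_left, kernel_apply]
  have hrow : ∀ x, ∑ y ∈ S, k (x - y) ≤ ∑' z, k z := fun x => by
    rw [← (Equiv.subLeft x).tsum_eq k]
    exact ((Equiv.subLeft x).summable_iff.2 hk).sum_le_tsum S fun y _ => hk0 _
  have hcol : ∀ y, ∑ x ∈ S, k (x - y) ≤ ∑' z, k z := fun y => by
    rw [← (Equiv.subRight y).tsum_eq k]
    exact ((Equiv.subRight y).summable_iff.2 hk).sum_le_tsum S fun x _ => hk0 _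
  have hK : 0 ≤ ∑' z, k z := tsum_nonneg hk0
  rw [e]
  calc ‖∑ x ∈ S, ∑ y ∈ S, inner ℂ (w x) (kernel A x y (u y))‖
      ≤ ∑ x ∈ S, ∑ y ∈ S, (k (x - y) * ‖w x‖ ^ 2 / 2 + k (x - y) * ‖u y‖ ^ 2 / 2) := by
        refine norm_sum_le_of_le _ fun x _ => norm_sum_le_of_le _ fun y _ => ?_
        have h1 : ‖kernel A x y (u y)‖ ≤ k (x - y) * ‖u y‖ :=
          ContinuousLinearMap.le_of_opNorm_le _ (h x y) _
        calc _ ≤ ‖w x‖ * ‖kernel A x y (u y)‖ := norm_inner_le_norm _ _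
          _ ≤ ‖w x‖ * (k (x - y) * ‖u y‖) := by gcongr
          _ ≤ _ := by nlinarith [mul_nonneg (hk0 (x - y)) (sq_nonneg (‖w x‖ - ‖u y‖))]
    _ = ∑ x ∈ S, (∑ y ∈ S, k (x - y)) * (‖w x‖ ^ 2 / 2) +
        ∑ y ∈ S, (∑ x ∈ S, k (x - y)) * (‖u y‖ ^ 2 / 2) := by
        simp only [Finset.sum_add_distrib, Finset.sum_mul, mul_div_assoc]
        congr 1
        exact Finset.sum_comm
    _ ≤ ∑ x ∈ S, (∑' z, k z) * (‖w x‖ ^ 2 / 2) + ∑ y ∈ S, (∑' z, k z) * (‖u y‖ ^ 2 / 2) := by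
        gcongr
        · exact hrow _
        · exact hcol _
    _ = (∑' z, k z) * (∑ x ∈ S, ‖w x‖ ^ 2 + ∑ y ∈ S, ‖u y‖ ^ 2) / 2 := by
        rw [← Finset.mul_sum, ← Finset.mul_sum, ← Finset.sum_div, ← Finset.sum_div]
        ring
    _ ≤ _ := by
        gcongr
        · exact sum_norm_sq_le S w
        · exact sum_norm_sq_le S u

theorem norm_inner_le_of_kernel_le {A : Op d} {k : Lattice → ℝ} (hk : Summable k)
    (hk0 : ∀ z, 0 ≤ k z) (h : ∀ x y, ‖kernel A x y‖ ≤ k (x - y)) (u w : State d) :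
    ‖inner ℂ w (A u)‖ ≤ (∑' z, k z) * (‖w‖ ^ 2 + ‖u‖ ^ 2) / 2 := by
  have hu := lp.hasSum_single (p := 2) (by norm_num) u
  have hw := lp.hasSum_single (p := 2) (by norm_num) w
  exact le_of_tendsto' ((Filter.Tendsto.inner hw ((A.continuous.tendsto u).comp hu)).norm)
    fun S => norm_inner_truncation_le hk hk0 h S u w

/-- Schur's test for kernels dominated by a summable convolution kernel. -/
theorem norm_le_tsum_of_kernel_le {A : Op d} {k : Lattice → ℝ} (hk : Summable k)
    (hk0 : ∀ z, 0 ≤ k z) (h : ∀ x y, ‖kernel A x y‖ ≤ k (x - y)) : ‖A‖ ≤ ∑' z, k z := by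
  have hK : 0 ≤ ∑' z, k z := tsum_nonneg hk0
  refine ContinuousLinearMap.opNorm_le_bound _ hK fun u => ?_
  rcases (norm_nonneg (A u)).eq_or_lt with h0 | h0
  · rw [← h0]
    positivity
  have hu : 0 < ‖u‖ := by
    refine norm_pos_iff.2 fun hu => ?_
    rw [hu, map_zero, norm_zero] at h0
    exact lt_irrefl _ h0
  -- Rescaling `Au` to the norm of `u` turns the mean of the two squares into `‖u‖²`.
  have h1 := norm_inner_le_of_kernel_le hk hk0 h u (((‖u‖ / ‖A u‖ : ℝ) : ℂ) • A u)
  rw [inner_smul_left, norm_mul, inner_self_eq_norm_sq_to_K, norm_smul] at h1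
  simp only [RCLike.norm_conj, Complex.norm_real, norm_pow, norm_norm, norm_div,
    RCLike.norm_ofReal, abs_norm] at h1
  have h2 : ‖u‖ / ‖A u‖ * ‖A u‖ = ‖u‖ := div_mul_cancel₀ _ h0.ne'
  rw [pow_two ‖A u‖, ← mul_assoc, h2] at h1
  refine le_of_mul_le_mul_left ?_ hu
  linarith

theorem summable_exp_neg_abs {μ : ℝ} (hμ : 0 < μ) :
    Summable fun n : ℤ => Real.exp (-μ * |(n : ℝ)|) := by
  have h : Summable fun n : ℕ => Real.exp (n * -μ) := Real.summable_exp_nat_mul_iff.2 (by linarith)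
  refine Summable.of_nat_of_neg ?_ ?_ <;> simpa [mul_comm] using h

theorem summable_exp_neg_norm {μ : ℝ} (hμ : 0 < μ) :
    Summable fun z : Lattice => Real.exp (-μ * ‖z‖) := by
  -- The sup norm is at least half the sum of the coordinates, hence the rate `μ / 2` in each of
  -- them.
  have h := summable_exp_neg_abs (half_pos hμ)
  have h2 := (h.mul_of_nonneg h (fun _ => (Real.exp_pos _).le) fun _ => (Real.exp_pos _).le)
  have h3 := (finTwoArrowEquiv ℤ).summable_iff.2 h2
  refine Summable.of_nonneg_of_le (fun _ => (Real.exp_pos _).le) (fun z => ?_) h3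
  simp only [Function.comp_apply, finTwoArrowEquiv_apply]
  rw [← Real.exp_add, Real.exp_le_exp]
  have h0 := norm_le_pi_norm z 0
  have h1 := norm_le_pi_norm z 1
  rw [Int.norm_eq_abs] at h0 h1
  change -μ * ‖z‖ ≤ -(μ / 2) * |(z 0 : ℝ)| + -(μ / 2) * |(z 1 : ℝ)|
  nlinarith

end SchurTest

/-! ### Exponential decay implies quasi-locality -/

section Decay

/-- Exponential decay of the kernel with respect to the norm of the lattice. -/
def HasExpDecay (A : Op d) : Prop :=
  ∃ C μ : ℝ, 0 ≤ C ∧ 0 < μ ∧ ∀ x y : Lattice, ‖kernel A x y‖ ≤ C * Real.exp (-μ * dist x y)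

theorem dist_le_dist_toPlane (x y : Lattice) : dist x y ≤ dist (toPlane x) (toPlane y) := by
  refine (dist_pi_le_iff dist_nonneg).2 fun j => ?_
  rw [Int.dist_eq, dist_eq_norm, ← Real.norm_eq_abs]
  exact PiLp.norm_apply_le (toPlane x - toPlane y) j

theorem dist_toPlane_le (x y : Lattice) : dist (toPlane x) (toPlane y) ≤ 2 * dist x y := by
  rw [EuclideanSpace.dist_eq]
  refine Real.sqrt_le_iff.2 ⟨by positivity, ?_⟩
  rw [Fin.sum_univ_two]
  have h : ∀ j, dist (toPlane x j) (toPlane y j) ≤ dist x y := fun j => by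
    have := dist_le_pi_dist x y j
    rwa [Int.dist_eq, ← Real.dist_eq] at this
  have h0 := h 0
  have h1 := h 1
  nlinarith [dist_nonneg (x := toPlane x 0) (y := toPlane y 0), dist_nonneg (x := x) (y := y),
    dist_nonneg (x := toPlane x 1) (y := toPlane y 1)]

theorem IsLocal.hasExpDecay {A : Op d} (h : IsLocal A) : HasExpDecay A := by
  obtain ⟨ν, hν, hA⟩ := h
  refine ⟨ν⁻¹, 2 * ν, by positivity, by positivity, fun x y => (hA x y).trans ?_⟩
  have := dist_le_dist_toPlane x y
  exact mul_le_mul_of_nonneg_left (Real.exp_le_exp.2 (by nlinarith)) (inv_nonneg.2 hν.le)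

theorem HasExpDecay.sub {A B : Op d} (hA : HasExpDecay A) (hB : HasExpDecay B) :
    HasExpDecay (A - B) := by
  obtain ⟨C, μ, hC, hμ, h⟩ := hA
  obtain ⟨C', μ', hC', hμ', h'⟩ := hB
  refine ⟨C + C', min μ μ', by positivity, lt_min hμ hμ', fun x y => ?_⟩
  rw [kernel_sub, add_mul]
  refine (norm_sub_le _ _).trans (add_le_add ((h x y).trans ?_) ((h' x y).trans ?_))
  · gcongr
    exact min_le_left _ _
  · gcongr
    exact min_le_right _ _

theorem HasExpDecay.mulOp_mul_mul {A : Op d} (hA : HasExpDecay A) {m m' : Lattice → ℂ}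
    (hm : ∀ x, ‖m x‖ ≤ 1) (hm' : ∀ x, ‖m' x‖ ≤ 1) :
    HasExpDecay (mulOp d m hm * A * mulOp d m' hm') := by
  obtain ⟨C, μ, hC, hμ, h⟩ := hA
  refine ⟨C, μ, hC, hμ, fun x y => ?_⟩
  rw [kernel_mul_mulOp, kernel_mulOp_mul, norm_smul, norm_smul]
  exact (mul_le_of_le_one_left (by positivity) (hm' y)).trans
    ((mul_le_of_le_one_left (by positivity) (hm x)).trans (h x y))

/-- The commutator has kernel `(m y - m x) A(x, y)`. Half of the exponential absorbs the factor
`dist x y`, and Schur's test sums the other half. -/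
theorem HasExpDecay.isQuasiLocal {A : Op d} (hA : HasExpDecay A) {ι : Type*} :
    IsQuasiLocal fun _ : ι => A := by
  obtain ⟨C, μ, hC, hμ, h⟩ := hA
  set K := ∑' z : Lattice, Real.exp (-(μ / 2) * ‖z‖) with hK
  have hK0 : 0 ≤ K := tsum_nonneg fun _ => (Real.exp_pos _).le
  refine ⟨.const _, fun ε hε => ⟨ε / (C * (2 / μ) * K + 1), by positivity, fun _ m hm hl => ?_⟩⟩
  set δ := ε / (C * (2 / μ) * K + 1) with hδ
  have hδ0 : 0 < δ := by positivity
  have key := norm_le_tsum_of_kernel_le (A := A * mulOp d m hm - mulOp d m hm * A)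
    (k := fun z => δ * (C * (2 / μ)) * Real.exp (-(μ / 2) * ‖z‖))
    ((summable_exp_neg_norm (half_pos hμ)).mul_left _) (fun z => by positivity) fun x y => by
      have h0 : m y • kernel A x y - m x • kernel A x y = (m y - m x) • kernel A x y :=
        (sub_smul _ _ _).symm
      rw [kernel_sub, kernel_mul_mulOp, kernel_mulOp_mul, h0, norm_smul, ← dist_eq_norm x y]
      have h1 : ‖m y - m x‖ ≤ δ * dist x y := by rw [norm_sub_rev]; exact hl x y
      have h2 : dist x y ≤ 2 / μ * Real.exp (μ / 2 * dist x y) := by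
        have := Real.add_one_le_exp (μ / 2 * dist x y)
        rw [div_mul_eq_mul_div, le_div_iff₀ hμ]
        linarith
      have h3 : Real.exp (-μ * dist x y) =
          Real.exp (-(μ / 2) * dist x y) * Real.exp (-(μ / 2) * dist x y) := by
        rw [← Real.exp_add]; ring_nf
      have h4 : Real.exp (μ / 2 * dist x y) * Real.exp (-(μ / 2) * dist x y) = 1 := by
        rw [← Real.exp_add]; ring_nf; exact Real.exp_zero
      calc ‖m y - m x‖ * ‖kernel A x y‖
          ≤ (δ * (2 / μ * Real.exp (μ / 2 * dist x y))) * (C * Real.exp (-μ * dist x y)) := by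
            refine mul_le_mul (h1.trans ?_) (h x y) (norm_nonneg _) (by positivity)
            gcongr
        _ = δ * (C * (2 / μ)) * (Real.exp (μ / 2 * dist x y) * Real.exp (-(μ / 2) * dist x y)) *
            Real.exp (-(μ / 2) * dist x y) := by rw [h3]; ring
        _ = _ := by rw [h4, mul_one]
  refine key.trans ?_
  rw [tsum_mul_left, ← hK]
  have h5 : δ * (C * (2 / μ) * K + 1) = ε := div_mul_cancel₀ _ (by positivity)
  nlinarith

end Decay

end Interface

namespace Interface

variable {d : ℕ}

/-! ### The interface Hamiltonian deep inside one phase -/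

section Edge

theorem mem_of_dist_le {Ω : Set Plane} {a x : Lattice} {R ρ : ℝ}
    (h : Metric.ball (toPlane a) R ⊆ Ω) (hR : 2 * ρ < R) (hx : dist x a ≤ ρ) : toPlane x ∈ Ω :=
  h (Metric.mem_ball.2 ((dist_toPlane_le x a).trans_lt (by linarith)))

theorem cutoff_mul_indicatorOp {Ω : Set Plane} {a : Lattice} {R ρ : ℝ}
    (h : Metric.ball (toPlane a) R ⊆ Ω) (hR : 2 * ρ < R) :
    cutoff d a ρ * indicatorOp d Ω = cutoff d a ρ := by
  refine mulOp_mul_mulOp _ _ _ fun x => ?_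
  by_cases hx : dist x a ≤ ρ
  · simp [hx, mem_of_dist_le h hR hx]
  · simp [hx]

theorem cutoff_mul_indicatorOp_compl {Ω : Set Plane} {a : Lattice} {R ρ : ℝ}
    (h : Metric.ball (toPlane a) R ⊆ Ω) (hR : 2 * ρ < R) :
    cutoff d a ρ * indicatorOp d Ωᶜ = 0 := by
  ext u x : 3
  rw [mul_apply_eq_comp, cutoff_apply]
  split_ifs with hx
  · rw [indicatorOp, mulOp_apply, if_neg (by simpa using mem_of_dist_le h hR hx)]
    simp
  · rfl

theorem norm_indicatorOp_le (Ω : Set Plane) : ‖indicatorOp d Ω‖ ≤ 1 := norm_mulOp_le _ _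

theorem one_sub_indicatorOp (Ω : Set Plane) : 1 - indicatorOp d Ω = indicatorOp d Ωᶜ := by
  ext u x : 3
  rw [sub_apply, one_apply_eq_self, lp.coeFn_sub, Pi.sub_apply, indicatorOp, indicatorOp,
    mulOp_apply, mulOp_apply]
  by_cases h : toPlane x ∈ Ω <;> simp [h]

/-- A frontier point in the ball would be interior. Nonemptiness matters because `Metric.infDist` to
the empty set is zero. -/
theorem le_infDist_frontier {Ω : Set Plane} (hne : (frontier Ω).Nonempty) {x : Plane} {r : ℝ}
    (h : Metric.ball x r ⊆ Ω) : r ≤ Metric.infDist x (frontier Ω) := by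
  refine (Metric.le_infDist hne).2 fun {y} hy => ?_
  by_contra hlt
  have h1 : y ∈ interior Ω :=
    interior_maximal h Metric.isOpen_ball (Metric.mem_ball'.2 (not_le.1 hlt))
  exact hy.2 h1

/-- The edge bound is uniform in `y` and not summable. Its geometric mean with the off-diagonal
decay is both small and summable. -/
theorem norm_cutoff_mul_le {A : Op d} {C μ b : ℝ} (hC : 0 ≤ C) (hμ : 0 < μ) (hb : 0 ≤ b)
    {a : Lattice} {ρ : ℝ} (h : ∀ x y, ‖kernel A x y‖ ≤ C * Real.exp (-μ * dist x y))
    (h' : ∀ x y, dist x a ≤ ρ → ‖kernel A x y‖ ≤ b) :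
    ‖cutoff d a ρ * A‖ ≤ Real.sqrt (b * C) * ∑' z : Lattice, Real.exp (-(μ / 2) * ‖z‖) := by
  rw [← tsum_mul_left]
  refine norm_le_tsum_of_kernel_le ((summable_exp_neg_norm (half_pos hμ)).mul_left _)
    (fun z => by positivity) fun x y => ?_
  rw [cutoff, kernel_mulOp_mul, norm_smul, ← dist_eq_norm x y]
  by_cases hx : dist x a ≤ ρ
  · rw [if_pos hx, norm_one, one_mul]
    refine abs_le_of_sq_le_sq' ?_ (by positivity) |>.2
    rw [mul_pow, Real.sq_sqrt (by positivity), ← Real.exp_nat_mul, pow_two]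
    refine (mul_le_mul (h' x y hx) (h x y) (norm_nonneg _) hb).trans_eq ?_
    rw [← mul_assoc]
    congr 2
    push_cast
    ring
  · rw [if_neg hx, norm_zero, zero_mul]
    positivity

theorem agreeNear_of_edgeOp {H Hp Hm : Op d} {Ω : Set Plane} (hH : HasExpDecay H)
    (hHp : HasExpDecay Hp) (hHm : HasExpDecay Hm) (hne : (frontier Ω).Nonempty)
    {c : ℕ → Lattice} (hc : ∀ n : ℕ, Metric.ball (toPlane (c n)) n ⊆ Ω) {ν : ℝ} (hν : 0 < ν)
    (hE : ∀ x y : Lattice, ‖kernel (edgeOp H Hp Hm Ω) x y‖ ≤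
      ν⁻¹ * Real.exp (-ν * Metric.infDist (toPlane x) (frontier Ω))) :
    AgreeNear c (fun _ => Hp) fun _ => H := by
  intro ρ ε hε
  obtain ⟨C, μ, hC, hμ, hdec⟩ : HasExpDecay (edgeOp H Hp Hm Ω) :=
    (hH.sub (hHp.mulOp_mul_mul _ _)).sub (hHm.mulOp_mul_mul _ _)
  obtain ⟨ρ₁, hρ₁, hq⟩ := (hHp.isQuasiLocal (ι := Unit)).exists_norm_cutoff_le ρ (half_pos hε)
  have hlim : Filter.Tendsto (fun n : ℕ => Real.sqrt (ν⁻¹ * Real.exp (-ν * (n - 2 * ρ)) * C) *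
      ∑' z : Lattice, Real.exp (-(μ / 2) * ‖z‖)) Filter.atTop (nhds 0) := by
    have h1 : Filter.Tendsto (fun n : ℕ => ν * ((n : ℝ) - 2 * ρ)) Filter.atTop Filter.atTop :=
      (Filter.tendsto_atTop_add_const_right _ _ tendsto_natCast_atTop_atTop).const_mul_atTop hν
    have h2 := (Real.tendsto_exp_neg_atTop_nhds_zero.comp h1)
    have h3 := ((((h2.const_mul ν⁻¹).mul_const C).sqrt).mul_const
      (∑' z : Lattice, Real.exp (-(μ / 2) * ‖z‖)))
    simpa [Function.comp_def] using h3
  obtain ⟨n₀, hn₀⟩ := Filter.eventually_atTop.1 (hlim.eventually_le_const (half_pos hε))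
  obtain ⟨n₁, hn₁⟩ := exists_nat_gt (2 * ρ₁)
  refine ⟨max n₀ n₁, fun n hn => ?_⟩
  have hn1 : 2 * ρ₁ < n := hn₁.trans_le (by exact_mod_cast (le_max_right _ _).trans hn)
  have hn2 : 2 * ρ < n := by linarith
  have e1 := cutoff_mul_indicatorOp (d := d) (hc n) hn2
  have e2 := cutoff_mul_indicatorOp_compl (d := d) (hc n) hn2
  have e3 := cutoff_mul_indicatorOp_compl (d := d) (hc n) hn1
  -- Near `c n` the indicator of Ω acts as one and that of the complement as zero. What is left is
  -- the hopping of `Hp` from the complement, which lies outside the `ρ₁`-ball, and the edge term.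
  have e : cutoff d (c n) ρ * (Hp - H) = cutoff d (c n) ρ * Hp * (1 - cutoff d (c n) ρ₁) *
      indicatorOp d Ωᶜ - cutoff d (c n) ρ * edgeOp H Hp Hm Ω := by
    have h1 : cutoff d (c n) ρ * edgeOp H Hp Hm Ω = cutoff d (c n) ρ * H -
        cutoff d (c n) ρ * indicatorOp d Ω * Hp * indicatorOp d Ω -
        cutoff d (c n) ρ * indicatorOp d Ωᶜ * Hm * indicatorOp d Ωᶜ := by
      rw [edgeOp]; noncomm_ring
    have h2 : cutoff d (c n) ρ * Hp * (1 - cutoff d (c n) ρ₁) * indicatorOp d Ωᶜ =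
        cutoff d (c n) ρ * Hp * indicatorOp d Ωᶜ := by
      rw [mul_sub, sub_mul, mul_assoc _ (cutoff d (c n) ρ₁), e3, mul_zero, sub_zero, mul_one]
    rw [h1, h2, e1, e2, ← one_sub_indicatorOp, mul_sub, mul_sub]
    simp
  rw [e]
  refine (norm_sub_le _ _).trans ?_
  have b1 : ‖cutoff d (c n) ρ * Hp * (1 - cutoff d (c n) ρ₁) * indicatorOp d Ωᶜ‖ ≤ ε / 2 :=
    (norm_mul_le_right (norm_indicatorOp_le _)).trans (hq ρ₁ le_rfl () (c n)).2
  have b2 := norm_cutoff_mul_le hC hμ (b := ν⁻¹ * Real.exp (-ν * (n - 2 * ρ))) (by positivity)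
    (a := c n) (ρ := ρ) hdec fun x y hx => (hE x y).trans (by
      have h1 : (n : ℝ) - 2 * ρ ≤ Metric.infDist (toPlane x) (frontier Ω) := by
        refine le_infDist_frontier hne fun z hz => hc n ?_
        rw [Metric.mem_ball] at hz ⊢
        have h2 := dist_triangle z (toPlane x) (toPlane (c n))
        have h3 := dist_toPlane_le x (c n)
        linarith
      exact mul_le_mul_of_nonneg_left (Real.exp_le_exp.2 (by nlinarith)) (inv_nonneg.2 hν.le))
  linarith [hn₀ n ((le_max_left _ _).trans hn)]

end Edge

/-! ### Fermi projections as limits of polynomials -/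

section FermiProjection

theorem exists_continuous_eqOn_spectrum {A : Type*} [CStarAlgebra A] {a b : A} {E : ℝ}
    (ha : (E : ℂ) ∉ spectrum ℂ a) (hb : (E : ℂ) ∉ spectrum ℂ b) :
    ∃ g : ℝ → ℝ, Continuous g ∧ Set.EqOn (fun t : ℝ => if t < E then (1 : ℝ) else 0) g
      (spectrum ℝ a ∪ spectrum ℝ b) := by
  have hopen : IsOpen (spectrum ℂ a ∪ spectrum ℂ b)ᶜ :=
    ((spectrum.isClosed a).union (spectrum.isClosed b)).isOpen_compl
  obtain ⟨δ, hδ, hball⟩ := Metric.isOpen_iff.1 hopen (E : ℂ) (by simp [ha, hb])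
  -- The ramp is one below `E - δ` and zero above `E`; neither spectrum meets the open interval of
  -- radius `δ` about `E`.
  refine ⟨fun t => max 0 (min 1 ((E - t) / δ)), by fun_prop, fun t ht => ?_⟩
  have ht' : (t : ℂ) ∈ spectrum ℂ a ∪ spectrum ℂ b :=
    ht.imp (fun h => (spectrum.algebraMap_mem_iff ℂ).2 h)
      fun h => (spectrum.algebraMap_mem_iff ℂ).2 h
  have hdist : δ ≤ |t - E| := by
    by_contra hlt
    refine hball (Metric.mem_ball.2 ?_) ht'
    rw [dist_eq_norm, ← Complex.ofReal_sub, Complex.norm_real, Real.norm_eq_abs]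
    exact not_le.1 hlt
  simp only
  split_ifs with h
  · rw [abs_of_neg (by linarith)] at hdist
    rw [min_eq_left (by rw [le_div_iff₀ hδ]; linarith), max_eq_right zero_le_one]
  · rw [max_eq_left]
    exact (min_le_right _ _).trans (div_nonpos_of_nonpos_of_nonneg (by linarith) hδ.le)

theorem isSelfAdjoint_fermiProj (H : Op d) (EF : ℝ) : IsSelfAdjoint (fermiProj H EF) :=
  cfc_predicate _ _

theorem fermiProj_mul_self {E : Type*} [NormedAddCommGroup E] [InnerProductSpace ℂ E]
    [CompleteSpace E] {H : E →L[ℂ] E} {EF : ℝ} (h : (EF : ℂ) ∉ spectrum ℂ H) :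
    fermiProj H EF * fermiProj H EF = fermiProj H EF := by
  obtain ⟨g, hg, hEq⟩ := exists_continuous_eqOn_spectrum h h
  have hcont : ContinuousOn (fun t : ℝ => if t < EF then (1 : ℝ) else 0) (spectrum ℝ H) :=
    hg.continuousOn.congr (hEq.mono Set.subset_union_left)
  rw [fermiProj, ← cfc_mul _ _ H hcont hcont]
  congr 1
  funext t
  split_ifs <;> simp

theorem exists_polynomial_fermiProj_near {H H' : Op d} {EF : ℝ} (hH : IsSelfAdjoint H)
    (hH' : IsSelfAdjoint H') (h : IsInsulating H EF) (h' : IsInsulating H' EF) {ε : ℝ}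
    (hε : 0 < ε) : ∃ p : Polynomial ℝ, ‖fermiProj H EF - Polynomial.aeval H p‖ ≤ ε ∧
      ‖fermiProj H' EF - Polynomial.aeval H' p‖ ≤ ε := by
  obtain ⟨g, hg, hEq⟩ := exists_continuous_eqOn_spectrum h h'
  rw [fermiProj, fermiProj, cfc_congr (hEq.mono Set.subset_union_left),
    cfc_congr (hEq.mono Set.subset_union_right)]
  exact exists_polynomial_cfc_near hH hH' hg hε

theorem isQuasiLocal_fermiProj {H : Op d} {EF : ℝ} (hH : IsSelfAdjoint H)
    (h : IsInsulating H EF) {ι : Type*} (hq : IsQuasiLocal fun _ : ι => H) :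
    IsQuasiLocal fun _ : ι => fermiProj H EF := by
  refine .of_forall_near fun ε hε => ?_
  obtain ⟨p, hp, -⟩ := exists_polynomial_fermiProj_near hH hH h h hε
  exact ⟨_, hp, hq.aeval p⟩

theorem agreeNear_fermiProj {H H' : Op d} {EF : ℝ} (hH : IsSelfAdjoint H)
    (hH' : IsSelfAdjoint H') (h : IsInsulating H EF) (h' : IsInsulating H' EF)
    (hq : IsQuasiLocal fun _ : ℕ => H) {c : ℕ → Lattice}
    (hA : AgreeNear c (fun _ => H) fun _ => H') :
    AgreeNear c (fun _ => fermiProj H EF) fun _ => fermiProj H' EF := by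
  refine .of_forall_near fun ε hε => ?_
  obtain ⟨p, hp, hp'⟩ := exists_polynomial_fermiProj_near hH hH' h h' hε
  exact ⟨_, _, hp, hp', hA.aeval hq p⟩

end FermiProjection

/-! ### Time reversal and multiplication operators -/

section TimeReversal

variable {Θ : State d →ₛₗ[starRingEnd ℂ] State d}

theorem IsTimeReversal.norm_map (h : IsTimeReversal Θ) (u : State d) : ‖Θ u‖ = ‖u‖ := by
  have := congrArg Complex.re (h.antiunitary u u)
  rw [inner_self_eq_norm_sq_to_K, inner_self_eq_norm_sq_to_K] at this
  simp [← Complex.ofReal_pow] at this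
  exact this

theorem IsTimeReversal.map_fermiProj (h : IsTimeReversal Θ) {H : Op d} {EF : ℝ}
    (hH : IsSelfAdjoint H) (hi : IsInvariant Θ H) (hg : IsInsulating H EF) (u : State d) :
    Θ (fermiProj H EF u) = fermiProj H EF (Θ u) := by
  obtain ⟨g, hg, hEq⟩ := exists_continuous_eqOn_spectrum hg hg
  rw [fermiProj, cfc_congr (hEq.mono Set.subset_union_left)]
  exact antilinear_cfc_comm hH Θ (C := 1) (fun u => by rw [one_mul, h.norm_map])
    (fun u => (hi u).symm) hg u

/-- A vector supported at `y` is a joint eigenvector of the positions with real eigenvalues, and Θ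
preserves these. -/
theorem IsTimeReversal.map_single_apply_of_ne (h : IsTimeReversal Θ) {x y : Lattice} (hxy : x ≠ y)
    (v : EuclideanSpace ℂ (Fin d)) : Θ (lp.single 2 y v) x = 0 := by
  obtain ⟨j, hj⟩ := Function.ne_iff.1 hxy
  have h1 := h.commutes_position j (lp.single 2 y v) ((y j : ℂ) • lp.single 2 y v) (fun z => by
    rw [lp.coeFn_smul, Pi.smul_apply]
    by_cases hz : z = y
    · rw [hz]
    · rw [lp.single_apply_ne _ _ _ hz, smul_zero, smul_zero]) x
  rw [map_smulₛₗ, map_intCast, lp.coeFn_smul, Pi.smul_apply] at h1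
  have h2 : ((x j : ℂ) - y j) • Θ (lp.single 2 y v) x = 0 := by rw [sub_smul, h1, sub_self]
  refine (smul_eq_zero.1 h2).resolve_left ?_
  refine sub_ne_zero.2 ?_
  exact_mod_cast hj

/-- Θ acts site by site and antilinearly, so it conjugates multipliers; vectors supported at one
site suffice by continuity. This makes flux compressions odd symmetric. -/
theorem IsTimeReversal.map_mulOp (h : IsTimeReversal Θ) {m m' : Lattice → ℂ}
    (hm : ∀ x, ‖m x‖ ≤ 1) (hm' : ∀ x, ‖m' x‖ ≤ 1) (hmm : ∀ x, m' x = starRingEnd ℂ (m x))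
    (u : State d) : Θ (mulOp d m hm u) = mulOp d m' hm' (Θ u) := by
  have hΘ : Continuous Θ :=
    AddMonoidHomClass.continuous_of_bound Θ 1 fun u => by rw [one_mul, h.norm_map]
  have hs : ∀ (y : Lattice) (v : EuclideanSpace ℂ (Fin d)),
      Θ (mulOp d m hm (lp.single 2 y v)) = mulOp d m' hm' (Θ (lp.single 2 y v)) := by
    intro y v
    have h1 : mulOp d m hm (lp.single 2 y v) = m y • lp.single 2 y v := by
      ext z : 2
      rw [mulOp_apply, lp.coeFn_smul, Pi.smul_apply]
      by_cases hz : z = y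
      · rw [hz]
      · rw [lp.single_apply_ne _ _ _ hz, smul_zero, smul_zero]
    ext z : 2
    rw [h1, map_smulₛₗ, mulOp_apply, lp.coeFn_smul, Pi.smul_apply]
    by_cases hz : z = y
    · rw [hz, hmm]
    · rw [h.map_single_apply_of_ne hz, smul_zero, smul_zero]
  have hu := lp.hasSum_single (p := 2) (by norm_num) u
  have h1 := (hu.mapL (mulOp d m hm)).map (Θ : State d →+ State d) hΘ
  have h2 := (hu.map (Θ : State d →+ State d) hΘ).mapL (mulOp d m' hm')
  refine h1.unique ?_
  refine h2.congr_fun ?_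
  exact fun y => hs y _

end TimeReversal

end Interface

namespace Interface

variable {d : ℕ}

/-! ### Flux-tube multipliers -/

section Profile

/-- The lattice as a subset of the complex plane. -/
noncomputable def toComplex (x : Lattice) : ℂ := (x 0 : ℂ) + Complex.I * (x 1 : ℂ)

theorem dist_le_norm_toComplex_sub (x y : Lattice) : dist x y ≤ ‖toComplex x - toComplex y‖ := by
  refine (dist_pi_le_iff (norm_nonneg _)).2 (Fin.forall_fin_two.2 ⟨?_, ?_⟩)
  · have := Complex.abs_re_le_norm (toComplex x - toComplex y)
    rw [Int.dist_eq]
    simpa [toComplex] using this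
  · have := Complex.abs_im_le_norm (toComplex x - toComplex y)
    rw [Int.dist_eq]
    simpa [toComplex] using this

theorem norm_toComplex_sub_le (x y : Lattice) : ‖toComplex x - toComplex y‖ ≤ 2 * dist x y := by
  refine (Complex.norm_le_abs_re_add_abs_im _).trans ?_
  have h0 := dist_le_pi_dist x y 0
  have h1 := dist_le_pi_dist x y 1
  rw [Int.dist_eq] at h0 h1
  have e0 : (toComplex x - toComplex y).re = x 0 - y 0 := by simp [toComplex]
  have e1 : (toComplex x - toComplex y).im = x 1 - y 1 := by simp [toComplex]
  rw [e0, e1]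
  linarith

/-- The radial retraction of `ℂ` onto the ball of radius `r`, rescaled to the unit ball. -/
noncomputable def profile (r : ℝ) (z : ℂ) : ℂ := z / (max r ‖z‖ : ℝ)

theorem norm_profile {r : ℝ} (hr : 0 < r) (z : ℂ) : ‖profile r z‖ = ‖z‖ / max r ‖z‖ := by
  rw [profile, norm_div, Complex.norm_real, Real.norm_eq_abs, abs_of_pos (lt_max_of_lt_left hr)]

theorem norm_profile_le {r : ℝ} (hr : 0 < r) (z : ℂ) : ‖profile r z‖ ≤ 1 := by
  rw [norm_profile hr]
  exact div_le_one_of_le₀ (le_max_right _ _) (hr.le.trans (le_max_left _ _))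

theorem norm_profile_eq_one {r : ℝ} (hr : 0 < r) {z : ℂ} (h : r ≤ ‖z‖) : ‖profile r z‖ = 1 := by
  rw [norm_profile hr, max_eq_right h, div_self (hr.trans_le h).ne']

theorem profile_eq_profile {r r' : ℝ} {z : ℂ} (h : r ≤ ‖z‖) (h' : r' ≤ ‖z‖) :
    profile r z = profile r' z := by
  rw [profile, profile, max_eq_right h, max_eq_right h']

/-- Smoothing the flux tube inside a ball of radius `r` makes it vary slowly, with slope of order
`1/r`. -/
theorem norm_profile_sub_le {r : ℝ} (hr : 0 < r) (z w : ℂ) :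
    ‖profile r z - profile r w‖ ≤ 2 / r * ‖z - w‖ := by
  set M := max r ‖z‖ with hM
  set N := max r ‖w‖ with hN
  have hM0 : 0 < M := lt_max_of_lt_left hr
  have hN0 : 0 < N := lt_max_of_lt_left hr
  have hrM : r ≤ M := le_max_left _ _
  have hwN : ‖w‖ ≤ N := le_max_right _ _
  have hMN : |N - M| ≤ ‖z - w‖ := by
    rw [abs_sub_comm, hM, hN, max_comm r ‖z‖, max_comm r ‖w‖]
    exact (abs_max_sub_max_le_abs _ _ _).trans (abs_norm_sub_norm_le z w)
  have e : profile r z - profile r w = (z - w) / (M : ℂ) + (w / N) * (((N - M : ℝ) : ℂ) / M) := by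
    rw [profile, profile, ← hM, ← hN]
    have h1 : (M : ℂ) ≠ 0 := by exact_mod_cast hM0.ne'
    have h2 : (N : ℂ) ≠ 0 := by exact_mod_cast hN0.ne'
    push_cast
    field_simp
    ring
  rw [e]
  refine (norm_add_le _ _).trans ?_
  rw [norm_mul, norm_div, norm_div, norm_div]
  simp only [Complex.norm_real, Real.norm_eq_abs, abs_of_pos hM0, abs_of_pos hN0]
  have b1 : ‖z - w‖ / M ≤ ‖z - w‖ / r := by gcongr
  have b2 : |N - M| / M ≤ ‖z - w‖ / r := by gcongr
  have b3 : ‖w‖ / N ≤ 1 := div_le_one_of_le₀ hwN hN0.le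
  have b4 : ‖w‖ / N * (|N - M| / M) ≤ ‖z - w‖ / r :=
    (mul_le_of_le_one_left (by positivity) b3).trans b2
  have e2 : 2 / r * ‖z - w‖ = ‖z - w‖ / r + ‖z - w‖ / r := by ring
  linarith

theorem exp_arg_eq_profile {z : ℂ} {r : ℝ} (hr : 0 < r) (h : r ≤ ‖z‖) :
    Complex.exp (Complex.I * (Complex.arg z : ℂ)) = profile r z := by
  have h0 : (‖z‖ : ℂ) ≠ 0 := by exact_mod_cast (hr.trans_le h).ne'
  rw [profile, max_eq_right h, eq_div_iff h0, mul_comm, mul_comm Complex.I]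
  exact Complex.norm_mul_exp_arg_mul_I z

/-- The multiplier of a flux tube at the lattice site `a`. -/
noncomputable def flux (a x : Lattice) : ℂ := profile 1 (toComplex x - toComplex a)

theorem norm_flux_le (a x : Lattice) : ‖flux a x‖ ≤ 1 := norm_profile_le one_pos _

end Profile

/-! ### Compressed flux operators and their defects -/

section Compression

/-- The compression of `L` to the range of `P`, extended by the identity. -/
noncomputable def compress (P L : Op d) : Op d := P * L * P + (1 - P)

theorem star_compress {P : Op d} (hP : IsSelfAdjoint P) (L : Op d) :
    star (compress P L) = compress P (star L) := by
  simp only [compress, star_add, star_mul, star_sub, star_one, hP.star_eq, mul_assoc]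

theorem isOddSymmetric_compress {Θ : State d →ₛₗ[starRingEnd ℂ] State d} (hΘ : IsTimeReversal Θ)
    {P L : Op d} (hP : IsSelfAdjoint P) (hPΘ : ∀ u, Θ (P u) = P (Θ u))
    (hL : ∀ u, Θ (L u) = star L (Θ u)) : IsOddSymmetric Θ (compress P L) where
  antiunitary := hΘ.antiunitary
  sq_eq_neg := hΘ.sq_eq_neg
  map_apply u := by
    rw [star_compress hP]
    simp only [compress, add_apply, sub_apply, mul_apply_eq_comp, one_apply_eq_self, map_add,
      map_sub, hPΘ, hL]

theorem one_sub_star_compress_mul {P : Op d} (hP : IsSelfAdjoint P) (hP2 : P * P = P) (L : Op d) :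
    1 - star (compress P L) * compress P L = P - P * star L * P * L * P := by
  rw [star_compress hP]
  have h1 : P * (1 - P) = 0 := by rw [mul_sub, mul_one, hP2, sub_self]
  have h2 : (1 - P) * P = 0 := by rw [sub_mul, one_mul, hP2, sub_self]
  have h3 : (1 - P) * (1 - P) = 1 - P := by rw [mul_sub, mul_one, h2, sub_zero]
  have e : compress P (star L) * compress P L = P * star L * (P * P) * L * P +
      P * star L * (P * (1 - P)) + (1 - P) * P * L * P + (1 - P) * (1 - P) := by
    simp only [compress]
    noncomm_ring
  rw [e, h1, h2, h3, hP2]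
  simp only [mul_zero, zero_mul, add_zero]
  abel

/-- The defect equals `P(1 - L*L)P + PL*(1 - P)[L, P]`, and each term is a quasi-local operator
times a concentrated one, up to a bounded right factor. -/
theorem isConcentrated_defect {ι : Type*} {c : ι → Lattice} {P : Op d} {L : ι → Op d}
    (hP : IsSelfAdjoint P) (hP2 : P * P = P) (hq : IsQuasiLocal fun _ : ι => P)
    (hL : IsQuasiLocal fun i => star (L i)) (hLP : IsConcentrated c fun i => L i * P - P * L i)
    (hLL : IsConcentrated c fun i => 1 - star (L i) * L i) :
    IsConcentrated c fun i => 1 - star (compress P (L i)) * compress P (L i) := by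
  have e : ∀ i, 1 - star (compress P (L i)) * compress P (L i) =
      P * ((1 - star (L i) * L i) * P) +
        P * star (L i) * (1 - P) * (L i * P - P * L i) := by
    intro i
    rw [one_sub_star_compress_mul hP hP2]
    have h2 : (1 - P) * P = 0 := by rw [sub_mul, one_mul, hP2, sub_self]
    have e1 : P * star (L i) * (1 - P) * (L i * P - P * L i) =
        P * star (L i) * (1 - P) * L i * P - P * star (L i) * ((1 - P) * P) * L i := by
      noncomm_ring
    have e2 : P * ((1 - star (L i) * L i) * P) = P * P - P * star (L i) * L i * P := by
      noncomm_ring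
    rw [e1, e2, h2, hP2]
    noncomm_ring
  simp only [e]
  exact ((hLL.mul_right (.const P)).mul_left hq).add
    (hLP.mul_left ((hq.mul hL).mul (IsQuasiLocal.one.sub hq)))

theorem norm_le_of_norm_apply_le {A : Op d} {ε : ℝ} (hε : 0 ≤ ε)
    (h : ∀ u x, ‖A u x‖ ≤ ε * ‖u x‖) : ‖A‖ ≤ ε := by
  refine ContinuousLinearMap.opNorm_le_bound _ hε fun u => ?_
  have h1 : ‖A u‖ ≤ ‖(ε : ℂ) • u‖ := lp.norm_mono two_ne_zero fun x => by
    rw [lp.coeFn_smul, Pi.smul_apply, norm_smul, Complex.norm_real, Real.norm_eq_abs,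
      abs_of_nonneg hε]
    exact h u x
  rwa [norm_smul, Complex.norm_real, Real.norm_eq_abs, abs_of_nonneg hε] at h1

theorem isConcentrated_mulOp_sub_mulOp {ι : Type*} {c : ι → Lattice} {m m' : ι → Lattice → ℂ}
    (hm : ∀ i x, ‖m i x‖ ≤ 1) (hm' : ∀ i x, ‖m' i x‖ ≤ 1)
    (h : ∀ ε : ℝ, 0 < ε → ∃ ρ, ∀ i x, ρ < dist x (c i) → ‖m i x - m' i x‖ ≤ ε) :
    IsConcentrated c fun i => mulOp d (m i) (hm i) - mulOp d (m' i) (hm' i) := by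
  refine ⟨(IsBddFamily.mulOp m hm).sub (.mulOp m' hm'), fun ε hε => ?_⟩
  obtain ⟨ρ₀, h0⟩ := h ε hε
  refine ⟨ρ₀, fun ρ hρ i => norm_le_of_norm_apply_le hε.le fun u x => ?_⟩
  classical
  rw [one_sub_cutoff_eq, mul_apply_eq_comp, mulOp_apply, sub_apply, lp.coeFn_sub, Pi.sub_apply,
    mulOp_apply, mulOp_apply, ← sub_smul]
  split_ifs with hx
  · rw [zero_smul, norm_zero]
    positivity
  · rw [one_smul, norm_smul]
    exact mul_le_mul_of_nonneg_right (h0 i x (hρ.trans_lt (not_le.1 hx))) (norm_nonneg _)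

/-- Multipliers that are asymptotic to the flux tubes at the centres `c`. -/
def IsFluxLike {ι : Type*} (c : ι → Lattice) (m : ι → Lattice → ℂ) : Prop :=
  ∀ ε : ℝ, 0 < ε → ∃ ρ, ∀ i x, ρ < dist x (c i) → ‖m i x - flux (c i) x‖ ≤ ε

theorem norm_conj_le {m : Lattice → ℂ} (hm : ∀ x, ‖m x‖ ≤ 1) (x : Lattice) :
    ‖starRingEnd ℂ (m x)‖ ≤ 1 := by
  rw [RCLike.norm_conj]
  exact hm x

/-- Replacing the flux tube by its smoothing at radius `r` changes it only within distance `r` of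
the centre, and the smoothing almost commutes with `P`. -/
theorem isConcentrated_commutator_flux {ι : Type*} (c : ι → Lattice) {P : Op d}
    (hq : IsQuasiLocal fun _ : ι => P) :
    IsConcentrated c fun i => mulOp d (flux (c i)) (norm_flux_le (c i)) * P -
      P * mulOp d (flux (c i)) (norm_flux_le (c i)) := by
  have hb : IsBddFamily fun i => mulOp d (flux (c i)) (norm_flux_le (c i)) := .mulOp _ _
  refine .of_forall_near ((hb.mul hq.1).sub (hq.1.mul hb)) fun ε hε => ?_
  obtain ⟨δ, hδ, h⟩ := hq.2 ε hε
  -- One factor 2 is the Lipschitz constant of the profile, the other compares the Euclidean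
  -- distance with the sup distance.
  set r : ℝ := max 1 (4 / δ) with hr
  have hr0 : 0 < r := lt_max_of_lt_left one_pos
  let m' : ι → Lattice → ℂ := fun i x => profile r (toComplex x - toComplex (c i))
  have hm' : ∀ i x, ‖m' i x‖ ≤ 1 := fun i x => norm_profile_le hr0 _
  have hD : IsConcentrated c fun i => mulOp d (flux (c i)) (norm_flux_le (c i)) -
      mulOp d (m' i) (hm' i) := by
    refine isConcentrated_mulOp_sub_mulOp _ hm' fun ε' hε' => ⟨r, fun i x hx => ?_⟩
    have h1 : r ≤ ‖toComplex x - toComplex (c i)‖ :=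
      hx.le.trans (dist_le_norm_toComplex_sub _ _)
    simp only [flux, m']
    rw [profile_eq_profile ((le_max_left _ _).trans h1) h1, sub_self, norm_zero]
    exact hε'.le
  refine ⟨_, (hD.mul_right (.const P)).sub (hD.mul_left hq), fun i => ?_⟩
  have e : ∀ X Y : Op d, X * P - P * X - ((X - Y) * P - P * (X - Y)) = -(P * Y - Y * P) := by
    intro X Y
    noncomm_ring
  rw [e, norm_neg]
  refine h i (m' i) (hm' i) fun x y => (norm_profile_sub_le hr0 _ _).trans ?_
  rw [sub_sub_sub_cancel_right]
  have h1 : 2 / r * 2 ≤ δ := by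
    have h2 : 4 / δ ≤ r := le_max_right _ _
    rw [div_le_iff₀ hδ] at h2
    rw [div_mul_eq_mul_div, div_le_iff₀ hr0]
    linarith
  calc 2 / r * ‖toComplex x - toComplex y‖ ≤ 2 / r * (2 * dist x y) := by
        gcongr
        exact norm_toComplex_sub_le x y
    _ = 2 / r * 2 * dist x y := by ring
    _ ≤ δ * dist x y := by gcongr

theorem isConcentrated_defect_of_isFluxLike {ι : Type*} {c : ι → Lattice} {P : Op d}
    (hP : IsSelfAdjoint P) (hP2 : P * P = P) (hq : IsQuasiLocal fun _ : ι => P)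
    {m : ι → Lattice → ℂ} (hm : ∀ i x, ‖m i x‖ ≤ 1) (h : IsFluxLike c m) :
    IsConcentrated c fun i => 1 - star (compress P (mulOp d (m i) (hm i))) *
      compress P (mulOp d (m i) (hm i)) := by
  have hstar : ∀ i, star (mulOp d (m i) (hm i)) =
      mulOp d (fun x => starRingEnd ℂ (m i x)) (norm_conj_le (hm i)) :=
    fun i => star_mulOp _ _ fun _ => rfl
  have hD := isConcentrated_mulOp_sub_mulOp (d := d) (c := c) hm (fun i => norm_flux_le (c i)) h
  refine isConcentrated_defect hP hP2 hq ?_ ?_ ?_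
  · simp only [hstar]
    exact .mulOp _ fun i => norm_conj_le (hm i)
  · have e : ∀ X Y : Op d, X * P - P * X =
        (Y * P - P * Y) + ((X - Y) * P - P * (X - Y)) := by
      intro X Y
      noncomm_ring
    simp only [fun i => e (mulOp d (m i) (hm i)) (mulOp d (flux (c i)) (norm_flux_le (c i)))]
    exact (isConcentrated_commutator_flux c hq).add
      ((hD.mul_right (.const P)).sub (hD.mul_left hq))
  · have hn : ∀ i x, ‖starRingEnd ℂ (m i x) * m i x‖ ≤ 1 := fun i x => by
      rw [norm_mul]
      exact mul_le_one₀ (norm_conj_le (hm i) x) (norm_nonneg _) (hm i x)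
    have e : ∀ i, 1 - star (mulOp d (m i) (hm i)) * mulOp d (m i) (hm i) =
        mulOp d (fun _ => 1) (fun _ => norm_one.le) -
          mulOp d (fun x => starRingEnd ℂ (m i x) * m i x) (hn i) := by
      intro i
      rw [hstar, mulOp_mul_mulOp _ _ (hn i) fun _ => rfl]
      congr 1
      ext u x : 3
      rw [mulOp_apply, one_smul, one_apply_eq_self]
    simp only [e]
    refine isConcentrated_mulOp_sub_mulOp (fun _ _ => norm_one.le) hn fun ε hε => ?_
    obtain ⟨ρ, hρ⟩ := h (ε / 2) (by positivity)
    refine ⟨max ρ 1, fun i x hx => ?_⟩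
    have h1 := hρ i x ((le_max_left _ _).trans_lt hx)
    have h2 : ‖flux (c i) x‖ = 1 := norm_profile_eq_one one_pos
      (((le_max_right _ _).trans hx.le).trans (dist_le_norm_toComplex_sub _ _))
    have h3 : 1 - starRingEnd ℂ (m i x) * m i x = ((1 - ‖m i x‖ ^ 2 : ℝ) : ℂ) := by
      rw [mul_comm, Complex.mul_conj, Complex.normSq_eq_norm_sq]
      push_cast
      ring
    have h4 := norm_sub_norm_le (flux (c i) x) (m i x)
    rw [norm_sub_rev, h2] at h4
    rw [h3, Complex.norm_real, Real.norm_eq_abs, abs_of_nonneg (by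
      have := hm i x
      nlinarith [norm_nonneg (m i x)])]
    nlinarith [hm i x, norm_nonneg (m i x)]

/-- On vectors vanishing in a large ball about the centre the form is at most `s / 2`. The rank is
therefore bounded by the degrees of freedom in the ball, a number independent of the centre. -/
theorem exists_finrank_upperRange_le {ι : Type*} {c : ι → Lattice} {A : ι → Op d}
    (hA : ∀ i, IsSelfAdjoint (A i)) (h : IsConcentrated c A) {s : ℝ} (hs : 0 < s) :
    ∃ N : ℕ, ∀ i, FiniteDimensional ℂ (upperRange (A i) s) ∧
      Module.finrank ℂ (upperRange (A i) s) ≤ N := by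
  obtain ⟨ρ, hρ⟩ := h.2 (s / 2) (half_pos hs)
  have hfin : Finite (Metric.closedBall (0 : Lattice) ρ) :=
    (isCompact_iff_finite.1 (isCompact_closedBall (0 : Lattice) ρ)).to_subtype
  refine ⟨Module.finrank ℂ (Metric.closedBall (0 : Lattice) ρ → EuclideanSpace ℂ (Fin d)),
    fun i => ?_⟩
  refine finrank_upperRange_le (hA i) (half_lt_self hs)
    (LinearMap.pi fun z : Metric.closedBall (0 : Lattice) ρ =>
      (lp.evalCLM ℂ (fun _ : Lattice => EuclideanSpace ℂ (Fin d)) 2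
        ((z : Lattice) + c i) : State d →ₗ[ℂ] EuclideanSpace ℂ (Fin d))) fun u hu => ?_
  have h0 : cutoff d (c i) ρ u = 0 := by
    ext x : 2
    rw [cutoff_apply]
    split_ifs with hx
    · have h1 : u (x - c i + c i) = 0 :=
        congrFun hu ⟨x - c i, by rwa [mem_closedBall_zero_iff, ← dist_eq_norm]⟩
      rwa [sub_add_cancel] at h1
    · rfl
  have h1 : IsSelfAdjoint (1 - cutoff d (c i) ρ) := by
    classical
    rw [one_sub_cutoff_eq]
    exact star_mulOp _ _ fun x => by split_ifs <;> simp
  have h2 : (1 - cutoff d (c i) ρ) u = u := by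
    rw [sub_apply, h0, sub_zero, one_apply_eq_self]
  have h3 : inner ℂ (A i u) u = inner ℂ (((1 - cutoff d (c i) ρ) * A i) u) u := by
    rw [mul_apply_eq_comp]
    have := (ContinuousLinearMap.isSelfAdjoint_iff_isSymmetric.1 h1) (A i u) u
    simp only [ContinuousLinearMap.coe_coe] at this
    rw [this, h2]
  rw [h3, pow_two, ← mul_assoc]
  refine (Complex.re_le_norm _).trans ((norm_inner_le_norm _ _).trans ?_)
  gcongr
  exact ContinuousLinearMap.le_of_opNorm_le _ (hρ ρ le_rfl i) u

end Compression

end Interface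

namespace Interface

variable {d : ℕ} {Θ : State d →ₛₗ[starRingEnd ℂ] State d}

/-! ### Moving the flux tube -/

section Homotopy

theorem isFluxLike_flux {ι : Type*} (c : ι → Lattice) : IsFluxLike c fun i => flux (c i) :=
  fun ε hε => ⟨0, fun i x _ => by rw [sub_self, norm_zero]; exact hε.le⟩

/-- Beyond radius `r` both tubes coincide with their smoothings at `r`, whose difference is at most
`2‖a‖/r`. -/
theorem isFluxLike_zero_flux (a : Lattice) : IsFluxLike (fun _ : Unit => 0) fun _ => flux a := by
  intro ε hε
  set r : ℝ := max 1 (2 * ‖toComplex a‖ / ε) with hr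
  have hr0 : 0 < r := lt_max_of_lt_left one_pos
  refine ⟨r + dist a 0, fun _ x hx => ?_⟩
  have h1 : r ≤ ‖toComplex x - toComplex a‖ := by
    refine le_trans ?_ (dist_le_norm_toComplex_sub x a)
    linarith [dist_triangle x a 0]
  have h2 : r ≤ ‖toComplex x - toComplex 0‖ := by
    refine le_trans ?_ (dist_le_norm_toComplex_sub x 0)
    linarith [dist_nonneg (x := a) (y := 0)]
  have h0 : toComplex 0 = 0 := by simp [toComplex]
  change ‖profile 1 (toComplex x - toComplex a) - profile 1 (toComplex x - toComplex 0)‖ ≤ ε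
  rw [profile_eq_profile ((le_max_left _ _).trans h1) h1,
    profile_eq_profile ((le_max_left _ _).trans h2) h2]
  refine (norm_profile_sub_le hr0 _ _).trans ?_
  rw [sub_sub_sub_cancel_left, h0, zero_sub, norm_neg, div_mul_eq_mul_div, div_le_iff₀ hr0]
  have h3 : 2 * ‖toComplex a‖ / ε ≤ r := le_max_right _ _
  rw [div_le_iff₀ hε] at h3
  linarith

theorem isFluxLike_zero_exp_arg : IsFluxLike (fun _ : Unit => 0) fun _ x =>
    Complex.exp (Complex.I * (Complex.arg ((x 0 : ℂ) + Complex.I * (x 1 : ℂ)) : ℂ)) := by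
  intro ε hε
  refine ⟨1, fun _ x hx => ?_⟩
  have h0 : toComplex 0 = 0 := by simp [toComplex]
  have h2 := hx.le.trans (dist_le_norm_toComplex_sub x 0)
  rw [h0, sub_zero] at h2
  have h3 : Complex.exp (Complex.I * (Complex.arg ((x 0 : ℂ) + Complex.I * (x 1 : ℂ)) : ℂ)) =
    profile 1 (toComplex x) := exp_arg_eq_profile one_pos h2
  change ‖Complex.exp (Complex.I * (Complex.arg ((x 0 : ℂ) + Complex.I * (x 1 : ℂ)) : ℂ)) -
    profile 1 (toComplex x - toComplex 0)‖ ≤ ε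
  rw [h3, h0, sub_zero, sub_self, norm_zero]
  exact hε.le

theorem norm_exp_arg_le (x : Lattice) :
    ‖Complex.exp (Complex.I * (Complex.arg ((x 0 : ℂ) + Complex.I * (x 1 : ℂ)) : ℂ))‖ ≤ 1 := by
  rw [mul_comm]
  exact (Complex.norm_exp_ofReal_mul_I _).le

theorem isOddSymmetric_compress_mulOp (hΘ : IsTimeReversal Θ) {P : Op d} (hP : IsSelfAdjoint P)
    (hPΘ : ∀ u, Θ (P u) = P (Θ u)) {m : Lattice → ℂ} (hm : ∀ x, ‖m x‖ ≤ 1) :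
    IsOddSymmetric Θ (compress P (mulOp d m hm)) :=
  isOddSymmetric_compress hΘ hP hPΘ fun u => by
    rw [star_mulOp hm (norm_conj_le hm) fun _ => rfl]
    exact hΘ.map_mulOp hm (norm_conj_le hm) (fun _ => rfl) u

theorem finiteDimensional_upperRange_defect {c : Unit → Lattice} {P : Op d} (hP : IsSelfAdjoint P)
    (hP2 : P * P = P) (hq : IsQuasiLocal fun _ : Unit => P) {m : Lattice → ℂ}
    (hm : ∀ x, ‖m x‖ ≤ 1) (h : IsFluxLike c fun _ => m) {s : ℝ} (hs : 0 < s) :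
    FiniteDimensional ℂ (upperRange (1 - star (compress P (mulOp d m hm)) *
      compress P (mulOp d m hm)) s) := by
  obtain ⟨N, hN⟩ := exists_finrank_upperRange_le
    (fun _ => IsOddSymmetric.isSelfAdjoint_defect _)
    (isConcentrated_defect_of_isFluxLike hP hP2 hq (fun _ => hm) h) hs
  exact (hN ()).1

/-- Both conditions on a multiplier, the bound by one and the asymptotics, are convex, so the
straight segment from `m` to `m'` is admissible although it need not be unimodular. The parity is
locally constant along it. -/
theorem even_finrank_ker_compress_congr (hΘ : IsTimeReversal Θ) {P : Op d} (hP : IsSelfAdjoint P)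
    (hP2 : P * P = P) (hPΘ : ∀ u, Θ (P u) = P (Θ u)) (hq : IsQuasiLocal fun _ : Unit => P)
    {m m' : Lattice → ℂ} (hm : ∀ x, ‖m x‖ ≤ 1) (hm' : ∀ x, ‖m' x‖ ≤ 1) {c : Unit → Lattice}
    (h : IsFluxLike c fun _ => m) (h' : IsFluxLike c fun _ => m') :
    Even (Module.finrank ℂ (LinearMap.ker
      (compress P (mulOp d m hm) : State d →ₗ[ℂ] State d))) ↔
    Even (Module.finrank ℂ (LinearMap.ker
      (compress P (mulOp d m' hm') : State d →ₗ[ℂ] State d))) := by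
  let n : unitInterval → Lattice → ℂ := fun t x => ((1 - t : ℝ) : ℂ) * m x + ((t : ℝ) : ℂ) * m' x
  have hconv : ∀ (t : unitInterval) (z w : ℂ) (b : ℝ), ‖z‖ ≤ b → ‖w‖ ≤ b →
      ‖((1 - t : ℝ) : ℂ) * z + ((t : ℝ) : ℂ) * w‖ ≤ b := by
    intro t z w b hz hw
    refine (norm_add_le _ _).trans ?_
    rw [norm_mul, norm_mul, Complex.norm_real, Complex.norm_real, Real.norm_eq_abs,
      Real.norm_eq_abs, abs_of_nonneg (sub_nonneg.2 t.2.2), abs_of_nonneg t.2.1]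
    nlinarith [t.2.1, t.2.2]
  have hn : ∀ t x, ‖n t x‖ ≤ 1 := fun t x => hconv t _ _ _ (hm x) (hm' x)
  have hflux : ∀ t, IsFluxLike c fun _ => n t := by
    intro t ε hε
    obtain ⟨ρ, hρ⟩ := h ε hε
    obtain ⟨ρ', hρ'⟩ := h' ε hε
    refine ⟨max ρ ρ', fun i x hx => ?_⟩
    have e : n t x - flux (c i) x = ((1 - t : ℝ) : ℂ) * (m x - flux (c i) x) +
        ((t : ℝ) : ℂ) * (m' x - flux (c i) x) := by
      simp only [n]
      push_cast
      ring
    rw [e]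
    exact hconv t _ _ _ (hρ i x ((le_max_left _ _).trans_lt hx))
      (hρ' i x ((le_max_right _ _).trans_lt hx))
  let T : unitInterval → Op d := fun t => compress P (mulOp d (n t) (hn t))
  have hT : Continuous fun t => 1 - star (T t) * T t := by
    have e : ∀ t, mulOp d (n t) (hn t) =
        ((1 - t : ℝ) : ℂ) • mulOp d m hm + ((t : ℝ) : ℂ) • mulOp d m' hm' := by
      intro t
      ext u x : 3
      rw [mulOp_apply, add_apply, smul_apply, smul_apply, lp.coeFn_add, Pi.add_apply,
        lp.coeFn_smul, Pi.smul_apply, lp.coeFn_smul, Pi.smul_apply, mulOp_apply, mulOp_apply,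
        smul_smul, smul_smul, ← add_smul]
    simp only [T, e, compress]
    fun_prop
  have hodd : ∀ t, IsOddSymmetric Θ (T t) :=
    fun t => isOddSymmetric_compress_mulOp hΘ hP hPΘ (hn t)
  have hfin : ∀ t (s : ℝ), 0 < s → FiniteDimensional ℂ (upperRange (1 - star (T t) * T t) s) :=
    fun t s hs => finiteDimensional_upperRange_defect hP hP2 hq (hn t) (hflux t) hs
  have hloc : IsLocallyConstant fun t =>
      Even (Module.finrank ℂ (LinearMap.ker (T t : State d →ₗ[ℂ] State d))) := by
    refine (IsLocallyConstant.iff_eventually_eq _).2 fun t => ?_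
    set N := Module.finrank ℂ (upperRange (1 - star (T t) * T t) (1 / 4)) with hN
    -- The largest `η` allowed by the stability lemma for rank bound `N`.
    have hη : (0 : ℝ) < 1 / 2 / (2 * N + 4) := by positivity
    filter_upwards [Metric.continuous_iff'.1 hT t _ hη] with s hs
    rw [dist_comm, dist_eq_norm] at hs
    refine propext ((hodd t).even_finrank_ker_iff (hodd s) (fun r hr _ => hfin t r hr)
      (fun r hr _ => hfin s r hr) (N := N) le_rfl hs ?_).symm
    rw [mul_div_cancel₀ _ (by positivity)]
  have key := hloc.apply_eq_of_isPreconnected isPreconnected_univ (Set.mem_univ 0) (Set.mem_univ 1)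
  have e0 : T 0 = compress P (mulOp d m hm) := by
    simp only [T]
    congr 2
    funext x
    simp [n]
  have e1 : T 1 = compress P (mulOp d m' hm') := by
    simp only [T]
    congr 2
    funext x
    simp [n]
  beta_reduce at key
  rw [e0, e1] at key
  exact iff_of_eq key

end Homotopy

/-! ### Comparison of indices and conclusion -/

section Comparison

theorem AgreeNear.exists_even_finrank_ker_compress_iff (hΘ : IsTimeReversal Θ) {P P' : Op d}
    (hP : IsSelfAdjoint P) (hP2 : P * P = P) (hPΘ : ∀ u, Θ (P u) = P (Θ u))
    (hq : IsQuasiLocal fun _ : ℕ => P) (hP' : IsSelfAdjoint P') (hP2' : P' * P' = P')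
    (hPΘ' : ∀ u, Θ (P' u) = P' (Θ u)) (hq' : IsQuasiLocal fun _ : ℕ => P') {c : ℕ → Lattice}
    (h : AgreeNear c (fun _ => P) fun _ => P') :
    ∃ a : Lattice,
      Even (Module.finrank ℂ (LinearMap.ker
        (compress P (mulOp d (flux a) (norm_flux_le a)) : State d →ₗ[ℂ] State d))) ↔
      Even (Module.finrank ℂ (LinearMap.ker
        (compress P' (mulOp d (flux a) (norm_flux_le a)) : State d →ₗ[ℂ] State d))) := by
  let M : ℕ → Op d := fun n => mulOp d (flux (c n)) (norm_flux_le (c n))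
  have hstar : ∀ n, star (M n) =
      mulOp d (fun x => starRingEnd ℂ (flux (c n) x)) (norm_conj_le (norm_flux_le (c n))) :=
    fun n => star_mulOp _ _ fun _ => rfl
  have hM : IsQuasiLocal M := .mulOp _ fun n => norm_flux_le (c n)
  have hM' : IsQuasiLocal fun n => star (M n) := by
    simp only [hstar]
    exact .mulOp _ fun n => norm_conj_le (norm_flux_le (c n))
  have hA := isConcentrated_defect_of_isFluxLike hP hP2 hq (fun n => norm_flux_le (c n))
    (isFluxLike_flux c)
  have hA' := isConcentrated_defect_of_isFluxLike hP' hP2' hq' (fun n => norm_flux_le (c n))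
    (isFluxLike_flux c)
  have hagree : AgreeNear c (fun n => 1 - star (compress P (M n)) * compress P (M n))
      fun n => 1 - star (compress P' (M n)) * compress P' (M n) := by
    simp only [one_sub_star_compress_mul hP hP2, one_sub_star_compress_mul hP' hP2']
    have q1 := hq.mul hM'
    have q2 := q1.mul hq
    have q3 := q2.mul hM
    have q1' := hq'.mul hM'
    have q2' := q1'.mul hq'
    have h1 := h.mul (.rfl_of fun n => star (M n)) hq hM'.1 hM'.1
    have h2 := h1.mul h q1 hq.1 hq'.1
    have h3 := h2.mul (.rfl_of M) q2 hM.1 hM.1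
    exact h.sub (h3.mul h q3 hq.1 hq'.1)
  have hfin : ∀ s : ℝ, 0 < s → ∃ N : ℕ, ∀ n, FiniteDimensional ℂ
      (upperRange (1 - star (compress P (M n)) * compress P (M n)) s) ∧ Module.finrank ℂ
      (upperRange (1 - star (compress P (M n)) * compress P (M n)) s) ≤ N :=
    fun s hs => exists_finrank_upperRange_le
      (fun _ => IsOddSymmetric.isSelfAdjoint_defect _) hA hs
  have hfin' : ∀ s : ℝ, 0 < s → ∃ N : ℕ, ∀ n, FiniteDimensional ℂ
      (upperRange (1 - star (compress P' (M n)) * compress P' (M n)) s) ∧ Module.finrank ℂ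
      (upperRange (1 - star (compress P' (M n)) * compress P' (M n)) s) ≤ N :=
    fun s hs => exists_finrank_upperRange_le
      (fun _ => IsOddSymmetric.isSelfAdjoint_defect _) hA' hs
  -- The rank bound is uniform in `n`, so the tolerance can be fixed before `n` is chosen.
  obtain ⟨N, hN⟩ := hfin (1 / 4) (by norm_num)
  have hη : (0 : ℝ) < 1 / 2 / (2 * N + 4) := by positivity
  obtain ⟨n, hn⟩ := hagree.exists_norm_sub_le hA hA' (half_pos hη)
  refine ⟨c n, (isOddSymmetric_compress_mulOp hΘ hP hPΘ _).even_finrank_ker_iff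
    (isOddSymmetric_compress_mulOp hΘ hP' hPΘ' _)
    (fun s hs _ => ((hfin s hs).choose_spec n).1) (fun s hs _ => ((hfin' s hs).choose_spec n).1)
    (hN n).2 ((hn n le_rfl).trans_lt (half_lt_self hη)) ?_⟩
  rw [mul_div_cancel₀ _ (by positivity)]

/-- The flux moves from the origin to a site where the two projections nearly agree, the projections
are exchanged there, and the flux moves back. -/
theorem index_eq_of_agreeNear (hΘ : IsTimeReversal Θ) {H H' : Op d} {EF : ℝ}
    (hH : IsHamiltonian Θ H) (hH' : IsHamiltonian Θ H') (hg : IsInsulating H EF)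
    (hg' : IsInsulating H' EF) {c : ℕ → Lattice} (h : AgreeNear c (fun _ => H) fun _ => H') :
    index H EF = index H' EF := by
  have hP := isSelfAdjoint_fermiProj H EF
  have hP' := isSelfAdjoint_fermiProj H' EF
  have hP2 : fermiProj H EF * fermiProj H EF = fermiProj H EF := fermiProj_mul_self hg
  have hP2' : fermiProj H' EF * fermiProj H' EF = fermiProj H' EF := fermiProj_mul_self hg'
  have hPΘ := hΘ.map_fermiProj hH.selfAdjoint hH.invariant hg
  have hPΘ' := hΘ.map_fermiProj hH'.selfAdjoint hH'.invariant hg'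
  have hdec := hH.isLocal.hasExpDecay
  have hdec' := hH'.isLocal.hasExpDecay
  obtain ⟨a, ha⟩ := (agreeNear_fermiProj hH.selfAdjoint hH'.selfAdjoint hg hg'
    hdec.isQuasiLocal h).exists_even_finrank_ker_compress_iff hΘ hP hP2 hPΘ
    (isQuasiLocal_fermiProj hH.selfAdjoint hg hdec.isQuasiLocal) hP' hP2' hPΘ'
    (isQuasiLocal_fermiProj hH'.selfAdjoint hg' hdec'.isQuasiLocal)
  have key := ((even_finrank_ker_compress_congr hΘ hP hP2 hPΘ
    (isQuasiLocal_fermiProj hH.selfAdjoint hg hdec.isQuasiLocal) norm_exp_arg_le (norm_flux_le a)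
    isFluxLike_zero_exp_arg (isFluxLike_zero_flux a)).trans ha).trans
    (even_finrank_ker_compress_congr hΘ hP' hP2' hPΘ'
    (isQuasiLocal_fermiProj hH'.selfAdjoint hg' hdec'.isQuasiLocal) (norm_flux_le a) norm_exp_arg_le
    (isFluxLike_zero_flux a) isFluxLike_zero_exp_arg)
  rw [index, index, ZMod.natCast_eq_natCast_iff']
  have hmod : ∀ a b : ℕ, (Even a ↔ Even b) → a % 2 = b % 2 := fun a b h => by
    rw [Nat.even_iff, Nat.even_iff] at h
    omega
  exact hmod _ _ key

theorem exists_lattice_ball_subset {Ω : Set Plane}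
    (h : ∀ R : ℝ, 0 < R → ∃ a : Plane, Metric.ball a R ⊆ Ω) (n : ℕ) :
    ∃ c : Lattice, Metric.ball (toPlane c) n ⊆ Ω := by
  -- The extra unit of radius absorbs the rounding error, at most `√(1/2)`.
  obtain ⟨a, ha⟩ := h (n + 1) (by positivity)
  refine ⟨fun j => round (a j), (Metric.ball_subset_ball' ?_).trans ha⟩
  rw [add_le_add_iff_left, EuclideanSpace.dist_eq]
  refine Real.sqrt_le_iff.2 ⟨zero_le_one, ?_⟩
  rw [Fin.sum_univ_two]
  have h1 : ∀ j, dist (toPlane (fun j => round (a j)) j) (a j) ≤ 1 / 2 := fun j => by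
    rw [dist_comm, Real.dist_eq]
    exact abs_sub_round (a j)
  nlinarith [h1 0, h1 1, dist_nonneg (x := toPlane (fun j => round (a j)) 0) (y := a 0),
    dist_nonneg (x := toPlane (fun j => round (a j)) 1) (y := a 1)]

theorem index_eq_of_edgeOp (hΘ : IsTimeReversal Θ) {H Hp Hm : Op d} {EF : ℝ}
    (hH : IsHamiltonian Θ H) (hHp : IsHamiltonian Θ Hp) (hHm : IsHamiltonian Θ Hm)
    (hg : IsInsulating H EF) (hgp : IsInsulating Hp EF) {Ω : Set Plane}
    (hΩ : ∀ R : ℝ, 0 < R → ∃ a : Plane, Metric.ball a R ⊆ Ω) (hne : (frontier Ω).Nonempty)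
    {ν : ℝ} (hν : 0 < ν) (hE : ∀ x y : Lattice, ‖kernel (edgeOp H Hp Hm Ω) x y‖ ≤
      ν⁻¹ * Real.exp (-ν * Metric.infDist (toPlane x) (frontier Ω))) :
    index Hp EF = index H EF := by
  choose c hc using exists_lattice_ball_subset hΩ
  exact index_eq_of_agreeNear hΘ hHp hH hgp hg (agreeNear_of_edgeOp hH.isLocal.hasExpDecay
    hHp.isLocal.hasExpDecay hHm.isLocal.hasExpDecay hne hc hν hE)

theorem edgeOp_compl (H Hp Hm : Op d) (Ω : Set Plane) :
    edgeOp H Hm Hp Ωᶜ = edgeOp H Hp Hm Ω := by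
  rw [edgeOp, edgeOp, compl_compl, sub_right_comm]

end Comparison

end Interface

theorem theorem1 (d : ℕ)
    (Θ : Interface.State d →ₛₗ[starRingEnd ℂ] Interface.State d)
    (hΘ : Interface.IsTimeReversal Θ)
    (EF : ℝ) (H : Interface.Op d)
    (hH : Interface.ModelsInterface Θ H EF) :
    (EF : ℂ) ∈ spectrum ℂ H := by
  by_contra hg
  obtain ⟨hH, Ω, Hp, Hm, hHp, hHm, hball, hgp, hgm, hne, ν, hν, hE⟩ := hH
  have hp : ∀ R : ℝ, 0 < R → ∃ a : Interface.Plane, Metric.ball a R ⊆ Ω := fun R hR => by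
    obtain ⟨a, -, ha, -⟩ := hball R hR
    exact ⟨a, ha⟩
  have hm : ∀ R : ℝ, 0 < R → ∃ a : Interface.Plane, Metric.ball a R ⊆ Ωᶜ := fun R hR => by
    obtain ⟨-, a, -, ha⟩ := hball R hR
    exact ⟨a, ha⟩
  -- The plane is connected, and Ω is neither empty nor everything.
  have hfr : (frontier Ω).Nonempty := by
    rw [Set.nonempty_iff_ne_empty]
    intro h0
    obtain ⟨a, ha⟩ := hp 1 one_pos
    obtain ⟨b, hb⟩ := hm 1 one_pos
    rcases isClopen_iff.1 (isClopen_iff_frontier_eq_empty.2 h0) with h | h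
    · have := ha (Metric.mem_ball_self one_pos)
      simp [h] at this
    · exact hb (Metric.mem_ball_self one_pos) (h ▸ Set.mem_univ b)
  -- The edge operator and the frontier are unchanged when `(Ω, Hp)` and `(Ωᶜ, Hm)` are exchanged,
  -- so one lemma treats both sides.
  refine hne ((Interface.index_eq_of_edgeOp hΘ hH hHp hHm hg hgp hp hfr hν hE).trans
    (Interface.index_eq_of_edgeOp hΘ hH hHm hHp hg hgm hm (by rwa [frontier_compl]) hν ?_).symm)
  simpa only [Interface.edgeOp_compl, frontier_compl] using hE
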